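/- Let $G=(V,E)$ be a finite simple $d$-regular graph with $d\ge 1$ and $n=|V|$ nodes. A \emph{random matching} $\mathbf M\sim\mathrm{RM}(G)$ is generated as follows: every edge of $G$ is put into a random set $S$ independently with probability $p$, and then every edge of $S$ that shares an endpoint with another edge of $S$ is removed; here $p$ is either of the two values $\frac1{4d}-\frac1{16d^2}$ and $\frac1{4d}-\frac1{64d^2}$. For a matching $\mathbf M$ let $\mathbf M^1x$ be the vector obtained from $x\in\mathbb R^V$ by replacing $x_i$ and $x_j$ by their average for each edge $\{i,j\}$ of $\mathbf M$. Put $$\Phi(x)=\sum_{i\in V}(x_i-\bar x)^2,\quad \bar x=\frac1n\sum_{j\in V} x_j,\qquad \Psi_G(x)=\sum_{\{i,j\}\in E}(x_i-x_j)^2 .$$ Let $\lambda=\lambda_1-\lambda_0$, where $\lambda_0\le\lambda_1\le\dots\le\lambda_{n-1}$ are the eigenvalues of the normalized Laplacian $I-A(G)/d$. Let $\mathrm{Res}(G)$ be the largest effective resistance (for unit edge weights) between two nodes of $G$, and let $H_E$ be the edge hitting time, that is, the maximum over adjacent nodes $i,j$ of the expected time that the simple random walk started at $i$ needs to reach $j$.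 A probability distribution $\mathcal D$ on matchings of $G$ is called \emph{$(g,\sigma^2)$-good} if $\sigma^2>1$, the function $g\colon[0,\infty)\to[0,\infty)$ is strictly increasing and positive on $(0,\infty)$, and for $\mathbf M\sim\mathcal D$ and all stochastic vectors $x$ (nonnegative entries with sum $1$) $$\Phi(x)-\mathbb E[\Phi(\mathbf M^1x)]\ge g(\Phi(x)),\qquad \operatorname{Var}[\Phi(\mathbf M^1x)]\le(\sigma^2-1)\bigl(\Phi(x)-\mathbb E[\Phi(\mathbf M^1x)]\bigr)^2 .$$ Then, for $\mathbf M\sim\mathrm{RM}(G)$: 1. For all $x\in\mathbb R^V$, $\ \Phi(x)-\mathbb E[\Phi(\mathbf M^1x)]\ge\frac1{16d}\Psi_G(x)$. 2. If $G$ is connected, then $H_E<\infty$ and for all $x\in\mathbb R^V$, $\ \operatorname{Var}[\Phi(\mathbf M^1x)]\le\bigl(32\,\tfrac{H_E}{n}+4\bigr)\bigl(\Phi(x)-\mathbb E[\Phi(\mathbf M^1x)]\bigr)^2$. 3. If $G$ is connected, then $\mathrm{RM}(G)$ is $(g_G,\sigma_G^2)$-good, where $$g_G(x)=\frac1{16d}\max\Bigl\{d\lambda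 x,\ \frac{x^2}{\mathrm{Res}(G)},\ \frac{4x^3}{27}\Bigr\},\qquad \sigma_G^2=32\,\frac{H_E}{n}+5 .$$ -/

import Mathlib

open MeasureTheory ProbabilityTheory
open scoped Matrix ENNReal

namespace LoadBalancing

section Potentials

/-- The quadratic node potential `Φ(x) = ∑ᵢ (xᵢ - x̄)²`, where `x̄` is the average of `x`. -/
noncomputable def nodePotential {V : Type*} [Fintype V] (x : V → ℝ) : ℝ :=
  ∑ i, (x i - (∑ j, x j) / (Fintype.card V : ℝ)) ^ 2

/-- The squared difference `(xᵢ - xⱼ)²` along the unordered pair `{i, j}`. -/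
def sqDiff {V : Type*} (x : V → ℝ) : Sym2 V → ℝ :=
  Sym2.lift ⟨fun i j => (x i - x j) ^ 2, fun i j => by ring⟩

/-- The quadratic edge potential `Ψ_G(x) = ∑_{{i,j} ∈ E(G)} (xᵢ - xⱼ)²`. -/
def edgePotential {V : Type*} [Fintype V] [DecidableEq V] (G : SimpleGraph V)
    [DecidableRel G.Adj] (x : V → ℝ) : ℝ :=
  ∑ e ∈ G.edgeFinset, sqDiff x e

end Potentials

section Spectrum

/-- The normalized Laplacian `I - A(G) / d` of a `d`-regular graph. -/
noncomputable def normLaplacian {V : Type*} [Fintype V] [DecidableEq V] (G : SimpleGraph V)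
    [DecidableRel G.Adj] (d : ℕ) : Matrix V V ℝ :=
  1 - (d : ℝ)⁻¹ • G.adjMatrix ℝ

theorem normLaplacian_isHermitian {V : Type*} [Fintype V] [DecidableEq V] (G : SimpleGraph V)
    [DecidableRel G.Adj] (d : ℕ) : (normLaplacian G d).IsHermitian := by
  unfold normLaplacian
  rw [Matrix.IsHermitian, Matrix.conjTranspose_eq_transpose_of_trivial]
  simp [Matrix.transpose_sub, Matrix.transpose_smul]

/-- The spectral gap `λ₁ - λ₀` of the normalized Laplacian, where `λ₀ ≤ λ₁ ≤ … ≤ λ_{n-1}` are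
its eigenvalues with multiplicity. Mathlib's `eigenvalues₀` lists them in decreasing order, so
`λ₀` and `λ₁` stand at the positions `n - 1` and `n - 2`. (A graph with fewer than two nodes gets
the value `0`.) -/
noncomputable def spectralGap {V : Type*} [Fintype V] [DecidableEq V] (G : SimpleGraph V)
    [DecidableRel G.Adj] (d : ℕ) : ℝ :=
  if h : 2 ≤ Fintype.card V then
    (normLaplacian_isHermitian G d).eigenvalues₀ ⟨Fintype.card V - 2, by omega⟩
      - (normLaplacian_isHermitian G d).eigenvalues₀ ⟨Fintype.card V - 1, by omega⟩
  else 0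

end Spectrum

section RandomWalk

/-- One step of the standard random walk: move to a uniformly random neighbour (an isolated node
is never left). -/
noncomputable def walkStep {V : Type*} [Fintype V] (G : SimpleGraph V) [DecidableRel G.Adj]
    (v : V) : PMF V :=
  if h : (G.neighborFinset v).Nonempty then PMF.uniformOfFinset (G.neighborFinset v) h
  else PMF.pure v

/-- The law of the trajectory `[X₀, X₁, …, X_t]` of the random walk started at `X₀ = v`. -/
noncomputable def walkLaw {V : Type*} [Fintype V] (G : SimpleGraph V) [DecidableRel G.Adj] :
    ℕ → V → PMF (List V)
  | 0, v => PMF.pure [v]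
  | t + 1, v => (walkStep G v).bind fun w => (walkLaw G t w).map (List.cons v)

/-- The hitting time `H(i, j)`, the expectation of the first time `τ` at which the random walk
started at `i` is at `j`. It is written as `E[τ] = ∑_{t ≥ 0} P(τ > t)`, where `τ > t` means that
`j` does not occur among `X₀, …, X_t`. -/
noncomputable def hittingTime {V : Type*} [Fintype V] (G : SimpleGraph V) [DecidableRel G.Adj]
    (i j : V) : ℝ≥0∞ :=
  ∑' t : ℕ, (walkLaw G t i).toOuterMeasure {l | j ∉ l}

/-- The edge hitting time `H_E(G)`: the maximum of `H(i, j)` over adjacent nodes `i`, `j`. -/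
noncomputable def edgeHittingTime {V : Type*} [Fintype V] (G : SimpleGraph V)
    [DecidableRel G.Adj] : ℝ≥0∞ :=
  ⨆ (i : V) (j : V) (_ : G.Adj i j), hittingTime G i j

end RandomWalk

section Resistance

/-- `f` is harmonic on `G` with the poles `i` and `j`: at every other node its value is the average
of its values at the neighbours. -/
def IsHarmonicWithPoles {V : Type*} [Fintype V] (G : SimpleGraph V) [DecidableRel G.Adj]
    (f : V → ℝ) (i j : V) : Prop :=
  ∀ k, k ≠ i → k ≠ j → f k = (1 / (G.degree k : ℝ)) * ∑ l ∈ G.neighborFinset k, f l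

/-- The effective resistance between `i` and `j`: the value
`|f(i) - f(j)| / ∑_{k ∈ N(i)} |f(k) - f(i)|`, which is the same for all harmonic functions `f` with
the poles `i` and `j` and with `f(i) ≠ f(j)`; the supremum merely picks this common value. It is `0`
for `i = j`, and `∞` for nodes in different components (where the denominator vanishes). -/
noncomputable def effResistance {V : Type*} [Fintype V] (G : SimpleGraph V) [DecidableRel G.Adj]
    (i j : V) : ℝ≥0∞ :=
  ⨆ (f : V → ℝ) (_ : IsHarmonicWithPoles G f i j) (_ : f i ≠ f j),
    ENNReal.ofReal |f i - f j| / ENNReal.ofReal (∑ k ∈ G.neighborFinset i, |f k - f i|)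

/-- The resistive diameter `Res(G)`: the largest effective resistance between two nodes. -/
noncomputable def resDiameter {V : Type*} [Fintype V] (G : SimpleGraph V) [DecidableRel G.Adj] :
    ℝ≥0∞ :=
  ⨆ (i : V) (j : V), effResistance G i j

end Resistance

section Matchings

/-- The matchings of `G`. -/
def Matching {V : Type*} (G : SimpleGraph V) : Type _ := {M : G.Subgraph // M.IsMatching}

instance {V : Type*} (G : SimpleGraph V) : MeasurableSpace (Matching G) := ⊤

open Classical in
/-- The balancing matrix of the matching `M` with balancing parameter `β`. -/
noncomputable def mixingMatrix {V : Type*} {G : SimpleGraph V} (M : Matching G) (β : ℝ) :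
    Matrix V V ℝ :=
  Matrix.of fun i j =>
    if i = j then (if i ∈ M.1.verts then 1 - β / 2 else 1)
    else (if M.1.Adj i j then β / 2 else 0)

/-- The subgraph formed by the edges of `G` that lie in `S` and share no endpoint with another edge
of `G` in `S`. -/
def isolatedEdges {V : Type*} (G : SimpleGraph V) (S : Set (Sym2 V)) : G.Subgraph where
  verts := {u | ∃ v, G.Adj u v ∧ s(u, v) ∈ S ∧
    ∀ e ∈ G.edgeSet, e ∈ S → (u ∈ e ∨ v ∈ e) → e = s(u, v)}
  Adj u v := G.Adj u v ∧ s(u, v) ∈ S ∧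
    ∀ e ∈ G.edgeSet, e ∈ S → (u ∈ e ∨ v ∈ e) → e = s(u, v)
  adj_sub h := h.1
  edge_vert h := ⟨_, h⟩
  symm := by
    refine ⟨fun u v => ?_⟩
    rintro ⟨h, hS, he⟩
    rw [Sym2.eq_swap] at hS he
    exact ⟨h.symm, hS, fun e h1 h2 h3 => he e h1 h2 h3.symm⟩

theorem isolatedEdges_isMatching {V : Type*} (G : SimpleGraph V) (S : Set (Sym2 V)) :
    (isolatedEdges G S).IsMatching := by
  rintro u ⟨v, h, hS, he⟩
  refine ⟨v, ⟨h, hS, he⟩, ?_⟩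
  rintro w ⟨h', hS', -⟩
  exact Sym2.congr_right.1 (he s(u, w) h' hS' (Or.inl (Sym2.mem_mk_left u w)))

/-- The local rule that turns an edge set `S` into a matching: drop every edge that
shares an endpoint with another edge of `S`. -/
def localMatching {V : Type*} (G : SimpleGraph V) (S : Set (Sym2 V)) : Matching G :=
  ⟨isolatedEdges G S, isolatedEdges_isMatching G S⟩

/-- The random matching distribution with sampling probability `p`: every edge of `G` enters
the random set `S` with probability `p`, independently of all other edges, and the edges of `S`
that share an endpoint with another edge of `S` are then dropped. -/
noncomputable def randomMatching {V : Type*} (G : SimpleGraph V) (p : unitInterval) :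
    Measure (Matching G) :=
  (setBernoulli G.edgeSet p).map (localMatching G)

theorem measurable_localMatching {V : Type*} [Finite V] (G : SimpleGraph V) :
    Measurable (localMatching G) := by
  have : MeasurableSingletonClass (Set (Sym2 V)) := inferInstance
  exact measurable_of_countable _

instance {V : Type*} [Finite V] (G : SimpleGraph V) (p : unitInterval) :
    IsProbabilityMeasure (randomMatching G p) :=
  Measure.isProbabilityMeasure_map (measurable_localMatching G).aemeasurable

/-- The expectation `E[Φ(M¹ x)]` for a random matching `M` with law `D`. -/
noncomputable def expPotential {V : Type*} [Fintype V] {G : SimpleGraph V}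
    (D : Measure (Matching G)) (x : V → ℝ) : ℝ :=
  ∫ M, nodePotential (mixingMatrix M 1 *ᵥ x) ∂D

/-- The variance `Var[Φ(M¹ x)]` for a random matching `M` with law `D`. -/
noncomputable def varPotential {V : Type*} [Fintype V] {G : SimpleGraph V}
    (D : Measure (Matching G)) (x : V → ℝ) : ℝ :=
  variance (fun M => nodePotential (mixingMatrix M 1 *ᵥ x)) D

/-- The matching distribution `D` is `(g, σ²)`-good. As `Φ` vanishes on the uniform vector, the
function `g` on `[0, ∞)` can be required to be positive only away from `0`. -/
structure IsGood {V : Type*} [Fintype V] {G : SimpleGraph V} (D : Measure (Matching G))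
    (g : ℝ → ℝ) (σsq : ℝ) : Prop where
  isProbabilityMeasure : IsProbabilityMeasure D
  nonneg : ∀ x, 0 ≤ x → 0 ≤ g x
  pos : ∀ x, 0 < x → 0 < g x
  increasing : StrictMonoOn g (Set.Ici 0)
  one_lt : 1 < σsq
  drift : ∀ x ∈ stdSimplex ℝ V,
    nodePotential x - expPotential D x ≥ g (nodePotential x)
  variance_le : ∀ x ∈ stdSimplex ℝ V,
    varPotential D x ≤ (σsq - 1) * (nodePotential x - expPotential D x) ^ 2

end Matchings

section Parameters

/-- `g_G(x) = (1 / (16 d)) · max {d λ x, x² / Res(G), 4 x³ / 27}`. -/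
noncomputable def driftFun {V : Type*} [Fintype V] [DecidableEq V] (G : SimpleGraph V)
    [DecidableRel G.Adj] (d : ℕ) (x : ℝ) : ℝ :=
  1 / (16 * (d : ℝ)) *
    max (max (d * spectralGap G d * x) (x ^ 2 / (resDiameter G).toReal)) (4 / 27 * x ^ 3)

/-- `σ_G² = 32 · H_E(G) / n + 5`. -/
noncomputable def sigmaSq {V : Type*} [Fintype V] (G : SimpleGraph V) [DecidableRel G.Adj] : ℝ :=
  32 * ((edgeHittingTime G).toReal / (Fintype.card V : ℝ)) + 5

end Parameters

end LoadBalancing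

open LoadBalancing

/-!
Balancing along a matching `M` lowers `Φ` by half the sum of `wₑ = (xᵢ - xⱼ)²` over the edges
`e = {i, j}` of `M` (`nodePotential_mixingMatrix_one`), so the random drop is a weighted count of
the survival events `e ∈ M`. By independence of the sampled edges, an edge survives with
probability `qₑ = p (1 - p)^m`, where `m ≤ 2 (d - 1)` counts the edges touching it, and Bernoulli's
inequality gives `qₑ ≥ 1 / (8 d)`. This is the bound on the mean.

For the variance, two touching edges never survive together, and two others share at most four
edges that have to be absent, so their joint survival probability is at most `5 qₑ q_f`. Hence the
variance is at most `∑ wₑ² qₑ / 4` plus four times the square of the mean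
(`variance_sum_indicator_le`). The first sum is governed by the largest `wₑ`. The function
`H(·, j) - H(·, i)` of hitting times has Laplacian `n d (δᵢ - δⱼ)`, so it is the potential of a
current from `i` to `j`, and the Cauchy–Schwarz inequality for the Dirichlet form yields
`wₑ ≤ (H(i, j) + H(j, i)) / (n d) · Ψ(x)` (`sq_sub_le_edgeHittingTime`). Finiteness of hitting times
comes from an explicit supersolution (`hittingTime_ne_top`).

For the drift function it remains to bound `Ψ` from below by `d λ Φ`, `Φ² / Res` and `4 Φ³ / 27`.
The first bound is the spectral theorem. For the other two, `Φ ≤ max x - 1 / n` for stochastic `x`;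
the second then is Dirichlet's principle, where the same potential and the maximum principle
identify the effective resistance with the commute time divided by `n d` (`effResistance_eq`). The
third follows a shortest path from a node of maximal load to a node of load below `1 / n + Φ / 3`:
it is short because all its earlier nodes carry a large load and the total load is `1`
(`cube_nodePotential_le`).
-/

namespace LoadBalancing

/-! ### Energy and currents -/

section Energy
variable {V : Type*}

@[simp]
theorem sqDiff_mk (x : V → ℝ) (i j : V) : sqDiff x s(i, j) = (x i - x j) ^ 2 := rfl

theorem sqDiff_nonneg (x : V → ℝ) (e : Sym2 V) : 0 ≤ sqDiff x e := by
  induction e with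
  | h i j => exact sq_nonneg _

variable [Fintype V] [DecidableEq V] (G : SimpleGraph V) [DecidableRel G.Adj]

theorem edgePotential_nonneg (x : V → ℝ) : 0 ≤ edgePotential G x :=
  Finset.sum_nonneg fun e _ => sqDiff_nonneg x e

/-- Summing over ordered adjacent pairs counts every edge twice. -/
theorem sum_adj_eq_two_mul_sum_edgeFinset (φ : Sym2 V → ℝ) :
    ∑ i, ∑ j, (if G.Adj i j then φ s(i, j) else 0) = 2 * ∑ e ∈ G.edgeFinset, φ e := by
  have h1 : ∑ a : G.Dart, φ a.edge = 2 * ∑ e ∈ G.edgeFinset, φ e := by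
    rw [← Finset.sum_fiberwise_of_maps_to (s := Finset.univ) (t := G.edgeFinset)
      (g := fun a : G.Dart => a.edge) (fun a _ => by simp), Finset.mul_sum]
    refine Finset.sum_congr rfl fun e he => ?_
    rw [Finset.sum_congr rfl (g := fun _ => φ e) (fun a ha => by
      rw [(Finset.mem_filter.1 ha).2]), Finset.sum_const, G.dart_edge_fiber_card e (by simpa using he)]
    simp
  rw [← h1, ← Finset.sum_product', ← Finset.sum_filter]
  symm
  refine Finset.sum_bij (fun a _ => a.toProd) (fun a _ => by simp)
    (fun a _ b _ h => SimpleGraph.Dart.ext _ _ h) (fun b hb => ?_) (fun a _ => rfl)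
  exact ⟨⟨b, by simpa using hb⟩, by simp, rfl⟩

theorem dotProduct_lapMatrix_self (x : V → ℝ) :
    x ⬝ᵥ (G.lapMatrix ℝ *ᵥ x) = edgePotential G x := by
  rw [← Matrix.toLinearMap₂'_apply', SimpleGraph.lapMatrix_toLinearMap₂', edgePotential,
    div_eq_iff two_ne_zero, mul_comm, ← sum_adj_eq_two_mul_sum_edgeFinset]
  rfl

theorem dotProduct_lapMatrix_comm (x y : V → ℝ) :
    x ⬝ᵥ (G.lapMatrix ℝ *ᵥ y) = y ⬝ᵥ (G.lapMatrix ℝ *ᵥ x) := by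
  rw [Matrix.dotProduct_mulVec, ← Matrix.mulVec_transpose, (G.isSymm_lapMatrix (R := ℝ)).eq,
    dotProduct_comm]

theorem sum_lapMatrix_mulVec (f : V → ℝ) : ∑ k, (G.lapMatrix ℝ *ᵥ f) k = 0 := by
  have h := dotProduct_lapMatrix_comm G (fun _ => 1) f
  rw [SimpleGraph.lapMatrix_mulVec_const_eq_zero] at h
  simpa [dotProduct] using h

/-- The Cauchy–Schwarz inequality for the Dirichlet form of `G`. -/
theorem sq_dotProduct_lapMatrix_le (x f : V → ℝ) :
    (x ⬝ᵥ (G.lapMatrix ℝ *ᵥ f)) ^ 2 ≤ edgePotential G x * edgePotential G f := by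
  have h := LinearMap.BilinForm.apply_sq_le_of_symm (Matrix.toLinearMap₂' ℝ (G.lapMatrix ℝ))
    (fun y => by
      rw [Matrix.toLinearMap₂'_apply', dotProduct_lapMatrix_self]; exact edgePotential_nonneg G y)
    ⟨fun y z => by
      simp only [Matrix.toLinearMap₂'_apply', RingHom.id_apply]
      exact dotProduct_lapMatrix_comm G _ _⟩ x f
  simpa only [Matrix.toLinearMap₂'_apply', dotProduct_lapMatrix_self] using h

/-- A potential whose Laplacian is `c (δᵢ - δⱼ)`, that is, one driving a current `c` from `i` to
`j`, pairs with `x` to `c (xᵢ - xⱼ)`. -/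
theorem dotProduct_lapMatrix_of_poles {f : V → ℝ} {i j : V} {c : ℝ} (hij : i ≠ j)
    (hi : (G.lapMatrix ℝ *ᵥ f) i = c) (hj : (G.lapMatrix ℝ *ᵥ f) j = -c)
    (hk : ∀ k, k ≠ i → k ≠ j → (G.lapMatrix ℝ *ᵥ f) k = 0) (x : V → ℝ) :
    x ⬝ᵥ (G.lapMatrix ℝ *ᵥ f) = c * (x i - x j) := by
  rw [dotProduct, Finset.sum_eq_add i j hij (fun k _ h => by rw [hk k h.1 h.2, mul_zero])
    (by simp) (by simp), hi, hj]
  ring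

/-- Dirichlet's principle: `(xᵢ - xⱼ)²` is at most the resistance `(fᵢ - fⱼ) / c` seen by the
potential `f` times the energy of `x`. -/
theorem sq_mul_sub_le_of_poles {f : V → ℝ} {i j : V} {c : ℝ} (hij : i ≠ j)
    (hi : (G.lapMatrix ℝ *ᵥ f) i = c) (hj : (G.lapMatrix ℝ *ᵥ f) j = -c)
    (hk : ∀ k, k ≠ i → k ≠ j → (G.lapMatrix ℝ *ᵥ f) k = 0) (x : V → ℝ) :
    (c * (x i - x j)) ^ 2 ≤ edgePotential G x * (c * (f i - f j)) := by
  rw [← dotProduct_lapMatrix_of_poles G hij hi hj hk x,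
    ← dotProduct_lapMatrix_of_poles G hij hi hj hk f, dotProduct_lapMatrix_self]
  exact sq_dotProduct_lapMatrix_le G x f

/-- Along a path of length `ℓ`, the end values differ by at most `√(ℓ Ψ)`. -/
theorem sq_sub_le_length_mul_edgePotential (x : V → ℝ) {u w : V} {p : G.Walk u w}
    (hp : p.IsPath) : (x u - x w) ^ 2 ≤ p.length * edgePotential G x := by
  have htel : x u - x w
      = ∑ i ∈ Finset.range p.length, (x (p.getVert i) - x (p.getVert (i + 1))) := by
    rw [Finset.sum_range_sub' fun i => x (p.getVert i)]
    simp
  have hinj := hp.getVert_injOn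
  calc (x u - x w) ^ 2
      ≤ (Finset.range p.length).card *
          ∑ i ∈ Finset.range p.length, (x (p.getVert i) - x (p.getVert (i + 1))) ^ 2 := by
        rw [htel]; exact sq_sum_le_card_mul_sum_sq
    _ = p.length * ∑ i ∈ Finset.range p.length,
          sqDiff x s(p.getVert i, p.getVert (i + 1)) := by simp
    _ ≤ p.length * edgePotential G x := by
        refine mul_le_mul_of_nonneg_left ?_ (by positivity)
        rw [← Finset.sum_image (f := sqDiff x)
          (g := fun i => s(p.getVert i, p.getVert (i + 1)))]
        · refine Finset.sum_le_sum_of_subset_of_nonneg ?_ fun e _ _ => sqDiff_nonneg x e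
          intro e he
          obtain ⟨i, hi, rfl⟩ := Finset.mem_image.1 he
          simpa using p.adj_getVert_succ (Finset.mem_range.1 hi)
        · intro a ha b hb hab
          simp only [Finset.coe_range, Set.mem_Iio] at ha hb
          have key : ∀ m n, m ≤ p.length → n ≤ p.length → p.getVert m = p.getVert n → m = n :=
            fun m n hm hn h => hinj hm hn h
          rcases Sym2.eq_iff.1 hab with ⟨h, -⟩ | ⟨h, h'⟩
          · exact key _ _ ha.le hb.le h
          -- An edge traversed in both directions would make the path revisit a node.
          · have h1 := key _ _ ha.le hb h
            have h2 := key _ _ ha hb.le h'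
            omega

end Energy

/-! ### Hitting times of the random walk -/

section Hitting
variable {V : Type*} [Fintype V] (G : SimpleGraph V) [DecidableRel G.Adj]

open Classical in
theorem survival_zero (i j : V) :
    (walkLaw G 0 i).toOuterMeasure {l | j ∉ l} = if i = j then 0 else 1 := by
  rw [walkLaw, PMF.toOuterMeasure_pure_apply]
  by_cases h : i = j
  · simp [h]
  · simp [h, Ne.symm h]

theorem survival_succ_of_ne (t : ℕ) {i j : V} (hij : i ≠ j) :
    (walkLaw G (t + 1) i).toOuterMeasure {l | j ∉ l}
      = ∑ w, walkStep G i w * (walkLaw G t w).toOuterMeasure {l | j ∉ l} := by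
  rw [walkLaw, PMF.toOuterMeasure_bind_apply, tsum_fintype]
  refine Finset.sum_congr rfl fun w _ => ?_
  rw [PMF.toOuterMeasure_map_apply]
  congr 2
  ext l
  simp [Ne.symm hij]

theorem survival_self (t : ℕ) (j : V) :
    (walkLaw G t j).toOuterMeasure {l | j ∉ l} = 0 := by
  cases t with
  | zero => simp [survival_zero]
  | succ t =>
    rw [walkLaw, PMF.toOuterMeasure_bind_apply]
    simp only [PMF.toOuterMeasure_map_apply, ENNReal.tsum_eq_zero, mul_eq_zero]
    intro w
    right
    have : List.cons j ⁻¹' {l | j ∉ l} = ∅ := by ext l; simp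
    rw [this, measure_empty]

theorem hittingTime_self (j : V) : hittingTime G j j = 0 := by
  simp [hittingTime, survival_self]

variable {G} {d : ℕ}

theorem sum_walkStep_mul (hd : 0 < d) (hreg : G.IsRegularOfDegree d) (i : V) (h : V → ℝ≥0∞) :
    ∑ w, walkStep G i w * h w = (d : ℝ≥0∞)⁻¹ * ∑ w ∈ G.neighborFinset i, h w := by
  have hc : (G.neighborFinset i).card = d := hreg i
  have hne : (G.neighborFinset i).Nonempty := Finset.card_pos.1 (hc ▸ hd)
  rw [walkStep, dif_pos hne, Finset.mul_sum]
  simp only [PMF.uniformOfFinset_apply, ite_mul, zero_mul, hc]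
  rw [← Finset.sum_filter]
  exact Finset.sum_congr (by ext; simp) fun _ _ => rfl

/-- First-step analysis of the hitting time. -/
theorem hittingTime_of_ne (hd : 0 < d) (hreg : G.IsRegularOfDegree d) {i j : V} (hij : i ≠ j) :
    hittingTime G i j
      = 1 + (d : ℝ≥0∞)⁻¹ * ∑ w ∈ G.neighborFinset i, hittingTime G w j := by
  rw [hittingTime, _root_.tsum_eq_zero_add' ENNReal.summable, survival_zero, if_neg hij]
  congr 1
  simp_rw [survival_succ_of_ne G _ hij]
  rw [Summable.tsum_finsetSum fun _ _ => ENNReal.summable, ← sum_walkStep_mul hd hreg]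
  simp_rw [ENNReal.tsum_mul_left]
  rfl

/-- The hitting time is the least nonnegative supersolution of its first-step equations. -/
theorem hittingTime_le_of_supersolution (hd : 0 < d) (hreg : G.IsRegularOfDegree d) {j : V}
    {g : V → ℝ≥0∞}
    (hg : ∀ i, i ≠ j → 1 + (d : ℝ≥0∞)⁻¹ * ∑ w ∈ G.neighborFinset i, g w ≤ g i) (i : V) :
    hittingTime G i j ≤ g i := by
  refine ENNReal.tsum_le_of_sum_range_le fun T => ?_
  induction T generalizing i with
  | zero => simp
  | succ T ih =>
    by_cases hij : i = j
    · subst hij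
      simp [survival_self]
    · rw [Finset.sum_range_succ', survival_zero, if_neg hij, add_comm]
      refine le_trans ?_ (hg i hij)
      gcongr
      simp_rw [survival_succ_of_ne G _ hij]
      rw [Finset.sum_comm, ← sum_walkStep_mul hd hreg]
      simp_rw [← Finset.mul_sum]
      gcongr with w
      exact ih w

/-- On a connected graph hitting times are finite. The supersolution is a concave function of the
distance to the target, growing by `(2 d) ^ (D - s)` from distance `s` to `s + 1`: the one
neighbour nearer to the target outweighs the `d - 1` others. -/
theorem hittingTime_ne_top (hd : 0 < d) (hreg : G.IsRegularOfDegree d) (hconn : G.Connected)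
    (i j : V) : hittingTime G i j ≠ ⊤ := by
  classical
  set D : ℕ := Finset.univ.sup fun v => G.dist v j with hD
  set gr : ℕ → ℕ := fun r => ∑ s ∈ Finset.range r, (2 * d) ^ (D - s) with hgr
  have hmono : Monotone gr := fun a b h =>
    Finset.sum_le_sum_of_subset (Finset.range_subset_range.2 h)
  -- The supersolution inequality multiplied by `d`, in the natural numbers.
  suffices hg : ∀ k, k ≠ j →
      ∑ w ∈ G.neighborFinset k, gr (G.dist w j) + d ≤ d * gr (G.dist k j) by
    refine ne_top_of_le_ne_top (ENNReal.natCast_ne_top (gr (G.dist i j)))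
      (hittingTime_le_of_supersolution hd hreg (g := fun k => (gr (G.dist k j) : ℝ≥0∞))
        (fun k hk => ?_) i)
    have hd0 : (d : ℝ≥0∞) ≠ 0 := by exact_mod_cast hd.ne'
    have hdt : (d : ℝ≥0∞) ≠ ⊤ := ENNReal.natCast_ne_top d
    have h1 : (∑ w ∈ G.neighborFinset k, (gr (G.dist w j) : ℝ≥0∞)) + d
        ≤ d * (gr (G.dist k j) : ℝ≥0∞) := by exact_mod_cast hg k hk
    calc 1 + (d : ℝ≥0∞)⁻¹ * ∑ w ∈ G.neighborFinset k, (gr (G.dist w j) : ℝ≥0∞)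
        = (d : ℝ≥0∞)⁻¹ * ((∑ w ∈ G.neighborFinset k, (gr (G.dist w j) : ℝ≥0∞)) + d) := by
          rw [mul_add, ENNReal.inv_mul_cancel hd0 hdt, add_comm]
      _ ≤ (d : ℝ≥0∞)⁻¹ * (d * (gr (G.dist k j) : ℝ≥0∞)) := by gcongr
      _ = gr (G.dist k j) := by rw [← mul_assoc, ENNReal.inv_mul_cancel hd0 hdt, one_mul]
  intro k hk
  obtain ⟨r, hr⟩ : ∃ r, G.dist k j = r + 1 :=
    Nat.exists_eq_succ_of_ne_zero (hconn.pos_dist_of_ne hk).ne'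
  have hrD : r + 1 ≤ D := hr ▸ Finset.le_sup (f := fun v => G.dist v j) (Finset.mem_univ k)
  obtain ⟨w₀, hadj, hw₀⟩ : ∃ w, G.Adj k w ∧ G.dist w j = r := by
    obtain ⟨p, hp⟩ := hconn.exists_walk_length_eq_dist k j
    cases p with
    | nil => exact absurd rfl hk
    | @cons _ w _ h q =>
      refine ⟨w, h, ?_⟩
      have h1 : G.dist w j ≤ q.length := SimpleGraph.dist_le q
      have h2 := hconn.dist_triangle (u := k) (v := w) (w := j)
      rw [SimpleGraph.dist_eq_one_iff_adj.2 h] at h2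
      simp only [SimpleGraph.Walk.length_cons] at hp
      omega
  have hmem : w₀ ∈ G.neighborFinset k := by simpa using hadj
  have hothers : ∑ w ∈ (G.neighborFinset k).erase w₀, gr (G.dist w j) ≤ (d - 1) * gr (r + 2) := by
    have hc : ((G.neighborFinset k).erase w₀).card = d - 1 := by
      rw [Finset.card_erase_of_mem hmem]
      congr 1
      exact hreg k
    rw [← hc, ← smul_eq_mul]
    refine Finset.sum_le_card_nsmul _ _ _ fun w hw => hmono ?_
    have hkw : G.Adj k w := by simpa using (Finset.mem_erase.1 hw).2
    have h2 := hconn.dist_triangle (u := w) (v := k) (w := j)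
    rw [SimpleGraph.dist_eq_one_iff_adj.2 hkw.symm] at h2
    omega
  rw [← Finset.add_sum_erase _ _ hmem, hw₀, hr]
  have e1 : gr (r + 1) = gr r + (2 * d) ^ (D - r) := Finset.sum_range_succ _ _
  have e2 : gr (r + 2) = gr (r + 1) + (2 * d) ^ (D - (r + 1)) := Finset.sum_range_succ _ _
  have e3 : (2 * d) ^ (D - r) = (2 * d) ^ (D - (r + 1)) * (2 * d) := by
    rw [← pow_succ]
    congr 1
    omega
  have hK : 1 ≤ (2 * d) ^ (D - (r + 1)) := Nat.one_le_pow _ _ (by omega)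
  generalize (2 * d) ^ (D - (r + 1)) = K at *
  obtain ⟨m, rfl⟩ : ∃ m, d = m + 1 := ⟨d - 1, by omega⟩
  simp only [Nat.add_sub_cancel] at hothers
  rw [e2, e1, e3] at hothers
  rw [e1, e3]
  nlinarith [Nat.mul_le_mul_left m hK]

theorem hittingTime_le_edgeHittingTime {i j : V} (h : G.Adj i j) :
    hittingTime G i j ≤ edgeHittingTime G :=
  le_iSup_of_le i (le_iSup_of_le j (le_iSup_of_le h le_rfl))

theorem edgeHittingTime_ne_top (hd : 0 < d) (hreg : G.IsRegularOfDegree d)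
    (hconn : G.Connected) : edgeHittingTime G ≠ ⊤ := by
  exact iSup_ne_top fun i => iSup_ne_top fun j => iSup_ne_top fun _ =>
    hittingTime_ne_top hd hreg hconn i j

theorem one_le_toReal_hittingTime (hd : 0 < d) (hreg : G.IsRegularOfDegree d)
    (hconn : G.Connected) {i j : V} (hij : i ≠ j) : 1 ≤ (hittingTime G i j).toReal := by
  rw [← ENNReal.toReal_one]
  refine ENNReal.toReal_mono (hittingTime_ne_top hd hreg hconn i j) ?_
  rw [hittingTime_of_ne hd hreg hij]
  exact le_self_add

variable (G) in
/-- The potential `H(·, j) - H(·, i)`, which drives a current of strength `n d` from `i` to `j`;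
its voltage is the commute time between `i` and `j`. -/
noncomputable def commutePotential (i j : V) (k : V) : ℝ :=
  (hittingTime G k j).toReal - (hittingTime G k i).toReal

theorem commutePotential_sub (i j : V) :
    commutePotential G i j i - commutePotential G i j j
      = (hittingTime G i j).toReal + (hittingTime G j i).toReal := by
  simp [commutePotential, hittingTime_self]

variable [DecidableEq V]

theorem lapMatrix_hittingTime_of_ne (hd : 0 < d) (hreg : G.IsRegularOfDegree d)
    (hconn : G.Connected) {k j : V} (hkj : k ≠ j) :
    (G.lapMatrix ℝ *ᵥ fun v => (hittingTime G v j).toReal) k = d := by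
  have h := congrArg ENNReal.toReal (hittingTime_of_ne hd hreg hkj)
  have hfin : ∀ w ∈ G.neighborFinset k, hittingTime G w j ≠ ⊤ :=
    fun w _ => hittingTime_ne_top hd hreg hconn w j
  rw [ENNReal.toReal_add ENNReal.one_ne_top (ENNReal.mul_ne_top
      (ENNReal.inv_ne_top.2 (by exact_mod_cast hd.ne')) (ENNReal.sum_ne_top.2 hfin)),
    ENNReal.toReal_mul, ENNReal.toReal_sum hfin] at h
  simp only [ENNReal.toReal_one, ENNReal.toReal_inv, ENNReal.toReal_natCast] at h
  have hd' : (d : ℝ) ≠ 0 := by exact_mod_cast hd.ne'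
  rw [SimpleGraph.lapMatrix_mulVec_apply, hreg k, h]
  field_simp
  ring

theorem lapMatrix_hittingTime_self (hd : 0 < d) (hreg : G.IsRegularOfDegree d)
    (hconn : G.Connected) (j : V) :
    (G.lapMatrix ℝ *ᵥ fun v => (hittingTime G v j).toReal) j = d - Fintype.card V * d := by
  have h := sum_lapMatrix_mulVec G fun v => (hittingTime G v j).toReal
  rw [← Finset.add_sum_erase _ _ (Finset.mem_univ j), Finset.sum_congr rfl (g := fun _ => (d : ℝ))
    (fun k hk => lapMatrix_hittingTime_of_ne hd hreg hconn (Finset.ne_of_mem_erase hk)),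
    Finset.sum_const, Finset.card_erase_of_mem (Finset.mem_univ j), nsmul_eq_mul,
    Finset.card_univ, Nat.cast_sub (Fintype.card_pos_iff.2 ⟨j⟩)] at h
  push_cast at h
  linarith

theorem lapMatrix_commutePotential (i j k : V) :
    (G.lapMatrix ℝ *ᵥ commutePotential G i j) k
      = (G.lapMatrix ℝ *ᵥ fun v => (hittingTime G v j).toReal) k
        - (G.lapMatrix ℝ *ᵥ fun v => (hittingTime G v i).toReal) k := by
  rw [← Pi.sub_apply, ← Matrix.mulVec_sub]
  rfl

theorem lapMatrix_commutePotential_left (hd : 0 < d) (hreg : G.IsRegularOfDegree d)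
    (hconn : G.Connected) {i j : V} (hij : i ≠ j) :
    (G.lapMatrix ℝ *ᵥ commutePotential G i j) i = Fintype.card V * d := by
  rw [lapMatrix_commutePotential, lapMatrix_hittingTime_of_ne hd hreg hconn hij,
    lapMatrix_hittingTime_self hd hreg hconn]
  ring

theorem lapMatrix_commutePotential_right (hd : 0 < d) (hreg : G.IsRegularOfDegree d)
    (hconn : G.Connected) {i j : V} (hij : i ≠ j) :
    (G.lapMatrix ℝ *ᵥ commutePotential G i j) j = -(Fintype.card V * d) := by
  rw [lapMatrix_commutePotential, lapMatrix_hittingTime_of_ne hd hreg hconn hij.symm,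
    lapMatrix_hittingTime_self hd hreg hconn]
  ring

theorem lapMatrix_commutePotential_of_ne (hd : 0 < d) (hreg : G.IsRegularOfDegree d)
    (hconn : G.Connected) {i j k : V} (hki : k ≠ i) (hkj : k ≠ j) :
    (G.lapMatrix ℝ *ᵥ commutePotential G i j) k = 0 := by
  rw [lapMatrix_commutePotential, lapMatrix_hittingTime_of_ne hd hreg hconn hki,
    lapMatrix_hittingTime_of_ne hd hreg hconn hkj, sub_self]

/-- The commute time bounds the resistance of an edge: `R(i, j) = (H(i, j) + H(j, i)) / (n d)`. -/
theorem sq_sub_le_edgeHittingTime (hd : 0 < d) (hreg : G.IsRegularOfDegree d)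
    (hconn : G.Connected) (x : V → ℝ) {i j : V} (hij : G.Adj i j) :
    (x i - x j) ^ 2
      ≤ 2 * (edgeHittingTime G).toReal / (Fintype.card V * d) * edgePotential G x := by
  have hn : (0 : ℝ) < Fintype.card V := by exact_mod_cast Fintype.card_pos_iff.2 ⟨i⟩
  have hc : (0 : ℝ) < Fintype.card V * d := mul_pos hn (by exact_mod_cast hd)
  have h := sq_mul_sub_le_of_poles G hij.ne
    (lapMatrix_commutePotential_left hd hreg hconn hij.ne)
    (lapMatrix_commutePotential_right hd hreg hconn hij.ne)
    (fun k => lapMatrix_commutePotential_of_ne hd hreg hconn) x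
  rw [commutePotential_sub] at h
  have hE := edgeHittingTime_ne_top hd hreg hconn
  have h1 := ENNReal.toReal_mono hE (hittingTime_le_edgeHittingTime hij)
  have h2 := ENNReal.toReal_mono hE (hittingTime_le_edgeHittingTime hij.symm)
  generalize (Fintype.card V : ℝ) * d = c at *
  have h3 : c * (c * (x i - x j) ^ 2) ≤ c * (2 * (edgeHittingTime G).toReal * edgePotential G x) := by
    calc c * (c * (x i - x j) ^ 2) = (c * (x i - x j)) ^ 2 := by ring
      _ ≤ _ := h
      _ = c * (((hittingTime G i j).toReal + (hittingTime G j i).toReal) * edgePotential G x) := by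
        ring
      _ ≤ _ := by
        refine mul_le_mul_of_nonneg_left ?_ hc.le
        exact mul_le_mul_of_nonneg_right (by linarith) (edgePotential_nonneg G x)
  rw [div_mul_eq_mul_div, le_div_iff₀ hc]
  linarith [le_of_mul_le_mul_left h3 hc]

end Hitting

/-! ### Bernoulli random sets -/

section Bernoulli

/-- The probability that a Bernoulli random subset of `u` contains `A ⊆ u` and avoids `B ⊆ u`,
for disjoint `A` and `B`. -/
theorem setBernoulli_real_subset_disjoint {ι : Type*} [Countable ι] [DecidableEq ι] (u : Set ι)
    (p : unitInterval) {A B : Finset ι} (hA : ↑A ⊆ u) (hB : ↑B ⊆ u) (hAB : Disjoint A B) :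
    (setBernoulli u p).real {S | ↑A ⊆ S ∧ Disjoint (B : Set ι) S}
      = (p : ℝ) ^ A.card * (1 - p) ^ B.card := by
  have hset : ((fun q : ι → Prop => {i | q i}) ⁻¹' {S | ↑A ⊆ S ∧ Disjoint (B : Set ι) S})
      = Set.pi ((A ∪ B : Finset ι) : Set ι) fun i => if i ∈ A then {True} else {False} := by
    ext q
    simp only [Set.mem_preimage, Set.mem_ofPred_eq, Set.mem_pi, Finset.coe_union, Set.mem_union,
      Finset.mem_coe, Set.disjoint_left, Set.subset_def]
    constructor
    · rintro ⟨h1, h2⟩ i hi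
      by_cases hiA : i ∈ A
      · simpa [hiA] using h1 i hiA
      · simpa [hiA] using h2 (hi.resolve_left hiA)
    · intro h
      refine ⟨fun i hi => by simpa [hi] using h i (Or.inl hi), fun i hi => ?_⟩
      simpa [Finset.disjoint_right.1 hAB hi] using h i (Or.inr hi)
  have hu : ∀ i ∈ A ∪ B, i ∈ u := fun i hi =>
    (Finset.mem_union.1 hi).elim (fun h => hA h) fun h => hB h
  have hprod : ∀ i ∈ A ∪ B, (unitInterval.toNNReal p • Measure.dirac (i ∈ u)
      + unitInterval.toNNReal (unitInterval.symm p) • Measure.dirac False)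
        (if i ∈ A then {True} else {False})
      = if i ∈ A then (unitInterval.toNNReal p : ℝ≥0∞)
        else unitInterval.toNNReal (unitInterval.symm p) := by
    intro i hi
    by_cases hiA : i ∈ A <;> simp [hiA, hu i hi]
  rw [measureReal_def, setBernoulli_apply', hset, Measure.infinitePi_pi _ (fun i _ => by measurability),
    Finset.prod_congr rfl hprod, Finset.prod_union hAB,
    Finset.prod_congr rfl (g := fun _ => (unitInterval.toNNReal p : ℝ≥0∞))
      (fun i hi => if_pos hi),
    Finset.prod_congr (s₁ := B) rfl
      (g := fun _ => (unitInterval.toNNReal (unitInterval.symm p) : ℝ≥0∞))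
      (fun i hi => if_neg (Finset.disjoint_right.1 hAB hi))]
  simp

end Bernoulli

/-! ### The potential drop along a matching -/

section MatchingPotential
variable {V : Type*} [Fintype V]

theorem nodePotential_eq (x : V → ℝ) :
    nodePotential x = ∑ i, x i ^ 2 - (∑ i, x i) ^ 2 / Fintype.card V := by
  rcases isEmpty_or_nonempty V with h | h
  · simp [nodePotential]
  have hn : (Fintype.card V : ℝ) ≠ 0 := by exact_mod_cast Fintype.card_ne_zero
  simp only [nodePotential, sub_sq, Finset.sum_add_distrib, Finset.sum_sub_distrib,
    ← Finset.sum_mul, ← Finset.mul_sum, Finset.sum_const, Finset.card_univ, nsmul_eq_mul]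
  field_simp
  ring

open Classical in
theorem mixingMatrix_one_mulVec {G : SimpleGraph V} (M : Matching G) (x : V → ℝ) (i : V) :
    (mixingMatrix M 1 *ᵥ x) i
      = x i - 1 / 2 * ∑ j, (if M.1.Adj i j then x i - x j else 0) := by
  by_cases hi : i ∈ M.1.verts
  · obtain ⟨j, hj, huniq⟩ := M.2 hi
    have hij : i ≠ j := hj.ne
    have h1 : ∀ k, M.1.Adj i k ↔ k = j := fun k => ⟨fun h => huniq k h, fun h => h ▸ hj⟩
    rw [Matrix.mulVec, dotProduct, Finset.sum_eq_add i j hij]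
    · simp [mixingMatrix, hi, hij, h1]
      ring
    · intro k _ hk
      simp [mixingMatrix, hk.1.symm, h1, hk.2]
    · simp
    · simp
  · have h1 : ∀ k, ¬ M.1.Adj i k := fun k h => hi (M.1.edge_vert h)
    rw [Matrix.mulVec, dotProduct, Finset.sum_eq_single i]
    · simp [mixingMatrix, hi, h1]
    · intro k _ hk
      simp [mixingMatrix, hk.symm, h1]
    · simp

open Classical in
/-- Balancing along a matching `M` lowers the potential by half the sum of the squared
differences along the edges of `M`. -/
theorem nodePotential_mixingMatrix_one {G : SimpleGraph V} [DecidableEq V] [DecidableRel G.Adj]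
    (M : Matching G) (x : V → ℝ) :
    nodePotential (mixingMatrix M 1 *ᵥ x)
      = nodePotential x
        - 1 / 2 * ∑ e ∈ G.edgeFinset, if e ∈ M.1.edgeSet then sqDiff x e else 0 := by
  set a : V → V → ℝ := fun i j => if M.1.Adj i j then 1 else 0 with ha
  have hsymm : ∀ i j, a i j = a j i := fun i j => by simp only [ha, M.1.adj_comm]
  set z : V → ℝ := fun i => ∑ j, a i j * (x i - x j) with hz
  have hy : mixingMatrix M 1 *ᵥ x = fun i => x i - 1 / 2 * z i := by
    ext i
    rw [mixingMatrix_one_mulVec]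
    simp [hz, ha]
  have hzsum : ∑ i, z i = 0 := by
    have h : ∑ i, z i = -∑ i, z i := by
      rw [hz, ← Finset.sum_neg_distrib, Finset.sum_comm]
      refine Finset.sum_congr rfl fun i _ => ?_
      rw [← Finset.sum_neg_distrib]
      exact Finset.sum_congr rfl fun j _ => by rw [hsymm]; ring
    linarith
  set T : ℝ := ∑ i, ∑ j, a i j * (x i - x j) ^ 2 with hT
  -- A node has at most one partner, so the square of `z i` is again a sum over partners.
  have hzsq : ∑ i, z i ^ 2 = T := by
    refine Finset.sum_congr rfl fun i _ => ?_
    by_cases hi : i ∈ M.1.verts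
    · obtain ⟨j, hj, huniq⟩ := M.2 hi
      have h1 : ∀ k, M.1.Adj i k ↔ k = j := fun k => ⟨fun h => huniq k h, fun h => h ▸ hj⟩
      simp [hz, ha, h1]
    · have h1 : ∀ k, ¬ M.1.Adj i k := fun k h => hi (M.1.edge_vert h)
      simp [hz, ha, h1]
  have hxz : 2 * ∑ i, x i * z i = T := by
    have e1 : ∑ i, x i * z i = ∑ i, ∑ j, a i j * (x i * (x i - x j)) := by
      refine Finset.sum_congr rfl fun i _ => ?_
      rw [hz, Finset.mul_sum]
      exact Finset.sum_congr rfl fun j _ => by ring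
    have e2 : ∑ i, x i * z i = ∑ i, ∑ j, a i j * (x j * (x j - x i)) := by
      rw [e1, Finset.sum_comm]
      exact Finset.sum_congr rfl fun i _ => Finset.sum_congr rfl fun j _ => by rw [hsymm]
    rw [two_mul]
    nth_rw 1 [e1]
    rw [e2, ← Finset.sum_add_distrib]
    refine Finset.sum_congr rfl fun i _ => ?_
    rw [← Finset.sum_add_distrib]
    exact Finset.sum_congr rfl fun j _ => by ring
  have hTe : T = 2 * ∑ e ∈ G.edgeFinset, if e ∈ M.1.edgeSet then sqDiff x e else 0 := by
    rw [← sum_adj_eq_two_mul_sum_edgeFinset]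
    refine Finset.sum_congr rfl fun i _ => Finset.sum_congr rfl fun j _ => ?_
    by_cases h : M.1.Adj i j
    · simp [ha, h, M.1.adj_sub h]
    · simp [ha, h]
  rw [hy, nodePotential_eq, nodePotential_eq, Finset.sum_sub_distrib, ← Finset.mul_sum, hzsum]
  have : ∑ i, (x i - 1 / 2 * z i) ^ 2 = ∑ i, x i ^ 2 - ∑ i, x i * z i + 1 / 4 * ∑ i, z i ^ 2 := by
    rw [Finset.mul_sum, ← Finset.sum_sub_distrib, ← Finset.sum_add_distrib]
    exact Finset.sum_congr rfl fun i _ => by ring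
  rw [this, hzsq, mul_zero, sub_zero]
  linarith

end MatchingPotential

/-! ### Weighted counts of events -/

section SecondMoment

theorem integral_sum_indicator {Ω ι : Type*} [MeasurableSpace Ω] [DiscreteMeasurableSpace Ω]
    [Finite Ω] (μ : Measure Ω) [IsProbabilityMeasure μ] (s : Finset ι) (A : ι → Set Ω)
    (c : ι → ℝ) :
    ∫ ω, ∑ e ∈ s, (A e).indicator (fun _ => c e) ω ∂μ = ∑ e ∈ s, c e * μ.real (A e) := by
  rw [integral_finsetSum _ fun e _ => .of_finite]
  refine Finset.sum_congr rfl fun e _ => ?_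
  rw [integral_indicator_const _ (.of_discrete), smul_eq_mul, mul_comm]

/-- A weighted count of events with mean `∑ cₑ qₑ` has variance at most
`∑ cₑ² qₑ + K (∑ cₑ qₑ)²` if any two of the events are at most `K + 1` times as likely to occur
together as independent ones. -/
theorem variance_sum_indicator_le {Ω ι : Type*} [MeasurableSpace Ω] [DiscreteMeasurableSpace Ω]
    [Finite Ω] (μ : Measure Ω) [IsProbabilityMeasure μ] (s : Finset ι) (A : ι → Set Ω)
    (c : ι → ℝ) (hc : ∀ e ∈ s, 0 ≤ c e) {K : ℝ} (hK : 0 ≤ K)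
    (hA : ∀ e ∈ s, ∀ f ∈ s, e ≠ f →
      μ.real (A e ∩ A f) ≤ (K + 1) * (μ.real (A e) * μ.real (A f))) :
    variance (fun ω => ∑ e ∈ s, (A e).indicator (fun _ => c e) ω) μ
      ≤ ∑ e ∈ s, c e ^ 2 * μ.real (A e) + K * (∑ e ∈ s, c e * μ.real (A e)) ^ 2 := by
  classical
  rw [variance_eq_sub .of_discrete, integral_sum_indicator]
  have h2 : ∫ ω, ((fun ω => ∑ e ∈ s, (A e).indicator (fun _ => c e) ω) ^ 2) ω ∂μ
      = ∑ e ∈ s, ∑ f ∈ s, c e * c f * μ.real (A e ∩ A f) := by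
    have h : ∀ ω, ((fun ω => ∑ e ∈ s, (A e).indicator (fun _ => c e) ω) ^ 2) ω
        = ∑ a ∈ s ×ˢ s, (A a.1 ∩ A a.2).indicator (fun _ => c a.1 * c a.2) ω := by
      intro ω
      rw [Pi.pow_apply, sq, Finset.sum_mul_sum, Finset.sum_product]
      refine Finset.sum_congr rfl fun e _ => Finset.sum_congr rfl fun f _ => ?_
      by_cases he : ω ∈ A e <;> by_cases hf : ω ∈ A f <;> simp [he, hf]
    simp_rw [h]
    rw [integral_sum_indicator μ (s ×ˢ s) (fun a => A a.1 ∩ A a.2) (fun a => c a.1 * c a.2),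
      Finset.sum_product]
  have h3 : ∑ e ∈ s, ∑ f ∈ s, c e * c f * μ.real (A e ∩ A f)
      ≤ ∑ e ∈ s, ∑ f ∈ s, ((if e = f then c e ^ 2 * μ.real (A e) else 0)
          + (K + 1) * ((c e * μ.real (A e)) * (c f * μ.real (A f)))) := by
    refine Finset.sum_le_sum fun e he => Finset.sum_le_sum fun f hf => ?_
    have hce := hc e he
    have hcf := hc f hf
    by_cases hef : e = f
    · subst hef
      rw [if_pos rfl, Set.inter_self, ← sq]
      have : 0 ≤ (K + 1) * ((c e * μ.real (A e)) * (c e * μ.real (A e))) := by positivity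
      linarith
    · rw [if_neg hef, zero_add]
      calc c e * c f * μ.real (A e ∩ A f)
          ≤ c e * c f * ((K + 1) * (μ.real (A e) * μ.real (A f))) := by
            gcongr
            exact hA e he f hf hef
        _ = _ := by ring
  have h4 : ∑ e ∈ s, ∑ f ∈ s, ((if e = f then c e ^ 2 * μ.real (A e) else 0)
          + (K + 1) * ((c e * μ.real (A e)) * (c f * μ.real (A f))))
      = ∑ e ∈ s, c e ^ 2 * μ.real (A e) + (K + 1) * (∑ e ∈ s, c e * μ.real (A e)) ^ 2 := by
    simp only [Finset.sum_add_distrib, Finset.sum_ite_eq]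
    congr 1
    · exact Finset.sum_congr rfl fun e he => if_pos he
    · rw [sq, Finset.sum_mul_sum, Finset.mul_sum]
      exact Finset.sum_congr rfl fun e _ => by rw [Finset.mul_sum]
  rw [h2]
  linarith

end SecondMoment

/-! ### Survival of edges in the random matching -/

section Survival
variable {V : Type*} [Fintype V] [DecidableEq V] (G : SimpleGraph V) [DecidableRel G.Adj]

/-- The edges of `G` other than `e` that share an endpoint with `e`. -/
def touchingEdges (e : Sym2 V) : Finset (Sym2 V) :=
  G.edgeFinset.filter fun f => f ≠ e ∧ ∃ v ∈ e, v ∈ f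

variable {G}

theorem mem_touchingEdges {e f : Sym2 V} :
    f ∈ touchingEdges G e ↔ f ∈ G.edgeSet ∧ f ≠ e ∧ ∃ v ∈ e, v ∈ f := by
  simp [touchingEdges]

theorem mem_touchingEdges_comm {e f : Sym2 V} (he : e ∈ G.edgeSet) (hf : f ∈ G.edgeSet) :
    f ∈ touchingEdges G e ↔ e ∈ touchingEdges G f := by
  simp only [mem_touchingEdges, he, hf, true_and]
  exact ⟨fun ⟨h, v, h1, h2⟩ => ⟨h.symm, v, h2, h1⟩, fun ⟨h, v, h1, h2⟩ => ⟨h.symm, v, h2, h1⟩⟩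

theorem mem_edgeSet_localMatching {e : Sym2 V} (he : e ∈ G.edgeSet) (S : Set (Sym2 V)) :
    e ∈ (localMatching G S).1.edgeSet
      ↔ ↑({e} : Finset (Sym2 V)) ⊆ S ∧ Disjoint (touchingEdges G e : Set (Sym2 V)) S := by
  induction e with
  | h u v =>
    rw [SimpleGraph.mem_edgeSet] at he
    simp only [localMatching, isolatedEdges, SimpleGraph.Subgraph.mem_edgeSet, he, true_and,
      Finset.coe_singleton, Set.singleton_subset_iff, Set.disjoint_left, Finset.mem_coe,
      mem_touchingEdges, Sym2.mem_iff, exists_eq_or_imp, exists_eq_left]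
    refine and_congr_right fun _ => ⟨fun h f hf hS => hf.2.1 (h f hf.1 hS hf.2.2),
      fun h f hf hS hm => ?_⟩
    by_contra hne
    exact h ⟨hf, hne, hm⟩ hS

theorem card_touchingEdges_le {d : ℕ} (hreg : G.IsRegularOfDegree d) {e : Sym2 V}
    (he : e ∈ G.edgeSet) : (touchingEdges G e).card ≤ 2 * (d - 1) := by
  induction e with
  | h u v =>
    rw [SimpleGraph.mem_edgeSet] at he
    have hsub : touchingEdges G s(u, v)
        ⊆ (G.incidenceFinset u).erase s(u, v) ∪ (G.incidenceFinset v).erase s(u, v) := by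
      intro f hf
      obtain ⟨h1, h2, w, hw, hwf⟩ := mem_touchingEdges.1 hf
      simp only [Finset.mem_union, Finset.mem_erase, SimpleGraph.mem_incidenceFinset,
        SimpleGraph.incidenceSet, Set.mem_sep_iff]
      rcases Sym2.mem_iff.1 hw with rfl | rfl
      · exact Or.inl ⟨h2, h1, hwf⟩
      · exact Or.inr ⟨h2, h1, hwf⟩
    have hu : ((G.incidenceFinset u).erase s(u, v)).card = d - 1 := by
      rw [Finset.card_erase_of_mem (by simpa [SimpleGraph.incidenceSet] using he),
        SimpleGraph.card_incidenceFinset_eq_degree, hreg u]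
    have hv : ((G.incidenceFinset v).erase s(u, v)).card = d - 1 := by
      rw [Finset.card_erase_of_mem (by simpa [SimpleGraph.incidenceSet] using he),
        SimpleGraph.card_incidenceFinset_eq_degree, hreg v]
    calc _ ≤ _ := Finset.card_le_card hsub
      _ ≤ _ := Finset.card_union_le _ _
      _ = _ := by rw [hu, hv]; ring

/-- Two edges without a common endpoint are both touched only by the (at most four) edges that
join an endpoint of the one to an endpoint of the other. -/
theorem card_touchingEdges_inter_le {e f : Sym2 V} (he : e ∈ G.edgeSet) (hf : f ∈ G.edgeSet)
    (hef : e ≠ f) (hnot : f ∉ touchingEdges G e) :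
    (touchingEdges G e ∩ touchingEdges G f).card ≤ 4 := by
  induction e with
  | h a b =>
    induction f with
    | h u v =>
      have hdisj : ∀ w, w ∈ s(a, b) → w ∉ s(u, v) := fun w h1 h2 =>
        hnot (mem_touchingEdges.2 ⟨hf, hef.symm, w, h1, h2⟩)
      have hsub : touchingEdges G s(a, b) ∩ touchingEdges G s(u, v)
          ⊆ {s(a, u), s(a, v), s(b, u), s(b, v)} := by
        intro g hg
        obtain ⟨hg1, hg2⟩ := Finset.mem_inter.1 hg
        obtain ⟨-, -, w, hw, hwg⟩ := mem_touchingEdges.1 hg1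
        obtain ⟨-, -, w', hw', hwg'⟩ := mem_touchingEdges.1 hg2
        have hne : w ≠ w' := fun h => hdisj w hw (h ▸ hw')
        rw [(Sym2.mem_and_mem_iff hne).1 ⟨hwg, hwg'⟩]
        rcases Sym2.mem_iff.1 hw with rfl | rfl <;> rcases Sym2.mem_iff.1 hw' with rfl | rfl <;> simp
      exact (Finset.card_le_card hsub).trans Finset.card_le_four

/-- An edge survives if it is sampled and none of the edges touching it is. -/
theorem randomMatching_real_mem (p : unitInterval) {e : Sym2 V} (he : e ∈ G.edgeSet) :
    (randomMatching G p).real {M | e ∈ M.1.edgeSet}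
      = (p : ℝ) * (1 - p) ^ (touchingEdges G e).card := by
  have h := setBernoulli_real_subset_disjoint G.edgeSet p (A := {e}) (B := touchingEdges G e)
    (by simpa using he) (fun f hf => (mem_touchingEdges.1 hf).1)
    (by simp [mem_touchingEdges])
  rw [Finset.card_singleton, pow_one] at h
  rw [← h, randomMatching, map_measureReal_apply (measurable_localMatching G) trivial]
  congr 1
  ext S
  exact mem_edgeSet_localMatching he S

/-- The survival events of two different edges are at most five times as likely to occur together
as independent ones: they exclude each other if the edges touch, and otherwise share at most four
edges that have to be absent. -/
theorem randomMatching_real_mem_inter_le (p : unitInterval) (hp : (p : ℝ) ≤ 1 / 4) {e f : Sym2 V}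
    (he : e ∈ G.edgeSet) (hf : f ∈ G.edgeSet) (hef : e ≠ f) :
    (randomMatching G p).real ({M | e ∈ M.1.edgeSet} ∩ {M | f ∈ M.1.edgeSet})
      ≤ (4 + 1) * ((randomMatching G p).real {M | e ∈ M.1.edgeSet}
          * (randomMatching G p).real {M | f ∈ M.1.edgeSet}) := by
  have hpre : (localMatching G) ⁻¹' ({M | e ∈ M.1.edgeSet} ∩ {M | f ∈ M.1.edgeSet})
      = {S | ↑({e, f} : Finset (Sym2 V)) ⊆ S
          ∧ Disjoint ((touchingEdges G e ∪ touchingEdges G f : Finset (Sym2 V)) : Set (Sym2 V))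
            S} := by
    ext S
    simp only [Set.mem_preimage, Set.mem_inter_iff, Set.mem_ofPred_eq,
      mem_edgeSet_localMatching he, mem_edgeSet_localMatching hf, Finset.coe_union,
      Set.disjoint_union_left, Finset.coe_insert, Finset.coe_singleton, Set.insert_subset_iff,
      Set.singleton_subset_iff]
    tauto
  by_cases hmem : f ∈ touchingEdges G e
  · have hempty : (localMatching G) ⁻¹' ({M | e ∈ M.1.edgeSet} ∩ {M | f ∈ M.1.edgeSet}) = ∅ := by
      rw [hpre, Set.eq_empty_iff_forall_notMem]
      rintro S ⟨h1, h2⟩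
      exact Set.disjoint_left.1 h2 (by simp [hmem]) (h1 (by simp) : f ∈ S)
    rw [randomMatching, map_measureReal_apply (measurable_localMatching G) trivial, hempty,
      measureReal_empty]
    positivity
  · have hprob := setBernoulli_real_subset_disjoint G.edgeSet p (A := {e, f})
      (B := touchingEdges G e ∪ touchingEdges G f)
      (by simp [Set.insert_subset_iff, he, hf])
      (fun g hg => by
        rcases Finset.mem_union.1 hg with h | h <;> exact (mem_touchingEdges.1 h).1)
      (by
        have h' : e ∉ touchingEdges G f := fun h => hmem ((mem_touchingEdges_comm he hf).2 h)
        have h1 : e ∉ touchingEdges G e := by simp [mem_touchingEdges]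
        have h2 : f ∉ touchingEdges G f := by simp [mem_touchingEdges]
        simp [hmem, h', h1, h2])
    rw [randomMatching_real_mem p he, randomMatching_real_mem p hf, randomMatching,
      map_measureReal_apply (measurable_localMatching G) trivial, hpre, hprob,
      Finset.card_pair hef]
    have hcard := Finset.card_union_add_card_inter (touchingEdges G e) (touchingEdges G f)
    have hint := card_touchingEdges_inter_le he hf hef hmem
    generalize (touchingEdges G e ∪ touchingEdges G f).card = a at *
    generalize (touchingEdges G e ∩ touchingEdges G f).card = b at *
    have hp0 : 0 ≤ (p : ℝ) := p.2.1
    have h1p : 0 ≤ 1 - (p : ℝ) := by linarith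
    -- The constant `5` comes from `(3 / 4) ^ 4 > 1 / 5`.
    have hb : 1 ≤ 5 * (1 - (p : ℝ)) ^ b := by
      have h1 : (1 - (p : ℝ)) ^ 4 ≤ (1 - (p : ℝ)) ^ b :=
        pow_le_pow_of_le_one h1p (by linarith) hint
      have h2 : (3 / 4 : ℝ) ^ 4 ≤ (1 - (p : ℝ)) ^ 4 := by
        gcongr
        linarith
      norm_num at h2
      linarith
    calc (p : ℝ) ^ 2 * (1 - p) ^ a = (p : ℝ) ^ 2 * (1 - p) ^ a * 1 := by ring
      _ ≤ (p : ℝ) ^ 2 * (1 - p) ^ a * (5 * (1 - (p : ℝ)) ^ b) := by gcongr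
      _ = 5 * (p ^ 2 * (1 - (p : ℝ)) ^ (a + b)) := by rw [pow_add]; ring
      _ = _ := by rw [hcard, pow_add]; ring

/-- Bernoulli's inequality bounds the survival probability: the sampling probability is about
`1 / (4 d)`, and with probability above `1 / 2` none of the at most `2 (d - 1)` touching edges is
sampled. -/
theorem le_survival_probability {d m : ℕ} (hd : 0 < d) (hm : m ≤ 2 * (d - 1)) {p : ℝ}
    (hp0 : 1 / (4 * (d : ℝ)) - 1 / (16 * (d : ℝ) ^ 2) ≤ p) (hp1 : p ≤ 1 / (4 * (d : ℝ))) :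
    1 / (8 * (d : ℝ)) ≤ p * (1 - p) ^ m := by
  have hd1 : (1 : ℝ) ≤ d := by exact_mod_cast hd
  have hdpos : (0 : ℝ) < d := by linarith
  set t : ℝ := 1 / (d : ℝ) with ht
  have ht0 : 0 < t := by positivity
  have ht1 : t ≤ 1 := by rw [ht, div_le_one hdpos]; exact hd1
  have htd : t * d = 1 := by rw [ht]; field_simp
  have e1 : 1 / (4 * (d : ℝ)) = t / 4 := by rw [ht]; field_simp
  have e2 : 1 / (16 * (d : ℝ) ^ 2) = t ^ 2 / 16 := by rw [ht]; field_simp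
  have e3 : 1 / (8 * (d : ℝ)) = t / 8 := by rw [ht]; field_simp
  rw [e1, e2] at hp0
  rw [e1] at hp1
  rw [e3]
  have hp0' : t / 4 - t ^ 2 / 16 ≥ 3 / 16 * t := by nlinarith
  have hb := one_add_mul_le_pow (a := -p) (by linarith) m
  have hm' : (m : ℝ) ≤ 2 * (d - 1) := by
    have : (m : ℝ) ≤ ((2 * (d - 1) : ℕ) : ℝ) := by exact_mod_cast hm
    rwa [Nat.cast_mul, Nat.cast_sub hd, Nat.cast_one, Nat.cast_two] at this
  have hmp : m * p ≤ 1 / 2 - t / 2 := by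
    calc (m : ℝ) * p ≤ (2 * (d - 1)) * (t / 4) := by
          apply mul_le_mul hm' hp1 (by linarith) (by linarith)
      _ = 1 / 2 - t / 2 := by linear_combination (1 / 2 : ℝ) * htd
  have hpow : 1 / 2 + t / 2 ≤ (1 - p) ^ m := by
    have : 1 + (m : ℝ) * -p ≤ (1 - p) ^ m := by simpa [sub_eq_add_neg] using hb
    linarith
  calc t / 8 ≤ (t / 4 - t ^ 2 / 16) * (1 / 2 + t / 2) := by nlinarith [mul_pos ht0 ht0]
    _ ≤ p * (1 - p) ^ m := mul_le_mul hp0 hpow (by linarith) (by linarith)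

end Survival

/-! ### Mean and variance of the potential drop -/

section DriftAndVariance
variable {V : Type*} [Fintype V]

instance (G : SimpleGraph V) : Finite (Matching G) :=
  inferInstanceAs (Finite {M : G.Subgraph // M.IsMatching})

instance (G : SimpleGraph V) : DiscreteMeasurableSpace (Matching G) := ⟨fun _ => trivial⟩

variable [DecidableEq V] {G : SimpleGraph V} [DecidableRel G.Adj]

theorem nodePotential_mixingMatrix_one_eq_indicator (M : Matching G) (x : V → ℝ) :
    nodePotential (mixingMatrix M 1 *ᵥ x) = nodePotential x
      - ∑ e ∈ G.edgeFinset,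
          {M : Matching G | e ∈ M.1.edgeSet}.indicator (fun _ => sqDiff x e / 2) M := by
  classical
  rw [nodePotential_mixingMatrix_one, Finset.mul_sum]
  congr 1
  refine Finset.sum_congr rfl fun e _ => ?_
  by_cases h : e ∈ M.1.edgeSet
  · simp [h]
    ring
  · simp [h]

theorem nodePotential_sub_expPotential (D : Measure (Matching G)) [IsProbabilityMeasure D]
    (x : V → ℝ) :
    nodePotential x - expPotential D x
      = ∑ e ∈ G.edgeFinset, sqDiff x e / 2 * D.real {M | e ∈ M.1.edgeSet} := by
  simp only [expPotential, nodePotential_mixingMatrix_one_eq_indicator]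
  rw [integral_sub .of_finite .of_finite, integral_sum_indicator]
  simp

theorem varPotential_eq (D : Measure (Matching G)) [IsProbabilityMeasure D] (x : V → ℝ) :
    varPotential D x
      = variance (fun M => ∑ e ∈ G.edgeFinset,
          {M : Matching G | e ∈ M.1.edgeSet}.indicator (fun _ => sqDiff x e / 2) M) D := by
  simp only [varPotential, nodePotential_mixingMatrix_one_eq_indicator]
  exact variance_const_sub (Measurable.of_discrete.aestronglyMeasurable) _

variable {d : ℕ}

theorem le_randomMatching_real_mem (hd : 0 < d) (hreg : G.IsRegularOfDegree d) {p : unitInterval}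
    (hp0 : 1 / (4 * (d : ℝ)) - 1 / (16 * (d : ℝ) ^ 2) ≤ p) (hp1 : (p : ℝ) ≤ 1 / (4 * (d : ℝ)))
    {e : Sym2 V} (he : e ∈ G.edgeFinset) :
    1 / (8 * (d : ℝ)) ≤ (randomMatching G p).real {M | e ∈ M.1.edgeSet} := by
  rw [SimpleGraph.mem_edgeFinset] at he
  rw [randomMatching_real_mem p he]
  exact le_survival_probability hd (card_touchingEdges_le hreg he) hp0 hp1

theorem drift_ge_edgePotential (hd : 0 < d) (hreg : G.IsRegularOfDegree d) {p : unitInterval}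
    (hp0 : 1 / (4 * (d : ℝ)) - 1 / (16 * (d : ℝ) ^ 2) ≤ p) (hp1 : (p : ℝ) ≤ 1 / (4 * (d : ℝ)))
    (x : V → ℝ) :
    1 / (16 * (d : ℝ)) * edgePotential G x
      ≤ nodePotential x - expPotential (randomMatching G p) x := by
  rw [nodePotential_sub_expPotential, edgePotential, Finset.mul_sum]
  refine Finset.sum_le_sum fun e he => ?_
  calc 1 / (16 * (d : ℝ)) * sqDiff x e = sqDiff x e / 2 * (1 / (8 * (d : ℝ))) := by ring
    _ ≤ _ := mul_le_mul_of_nonneg_left (le_randomMatching_real_mem hd hreg hp0 hp1 he)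
        (div_nonneg (sqDiff_nonneg x e) zero_le_two)

/-- The diagonal part `∑ wₑ² qₑ / 4` of the variance is controlled by the largest `wₑ`, which is
at most `2 H_E / (n d)` times the edge potential, and hence at most `32 H_E / n` times the drift;
the rest of the variance is at most `4` times the square of the drift. -/
theorem varPotential_randomMatching_le (hd : 0 < d) (hreg : G.IsRegularOfDegree d)
    (hconn : G.Connected) {p : unitInterval}
    (hp0 : 1 / (4 * (d : ℝ)) - 1 / (16 * (d : ℝ) ^ 2) ≤ p) (hp1 : (p : ℝ) ≤ 1 / (4 * (d : ℝ)))
    (x : V → ℝ) :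
    varPotential (randomMatching G p) x
      ≤ (32 * ((edgeHittingTime G).toReal / (Fintype.card V : ℝ)) + 4)
          * (nodePotential x - expPotential (randomMatching G p) x) ^ 2 := by
  have hd1 : (1 : ℝ) ≤ d := by exact_mod_cast hd
  have hp4 : (p : ℝ) ≤ 1 / 4 :=
    hp1.trans (one_div_le_one_div_of_le (by norm_num) (by linarith))
  have hvar := variance_sum_indicator_le (randomMatching G p) G.edgeFinset
    (fun e => {M : Matching G | e ∈ M.1.edgeSet}) (fun e => sqDiff x e / 2)
    (fun e _ => div_nonneg (sqDiff_nonneg x e) zero_le_two) (K := 4) (by norm_num)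
    (fun e he f hf hef => randomMatching_real_mem_inter_le p hp4
      (SimpleGraph.mem_edgeFinset.1 he) (SimpleGraph.mem_edgeFinset.1 hf) hef)
  have hdrift := drift_ge_edgePotential hd hreg hp0 hp1 x
  rw [← varPotential_eq, ← nodePotential_sub_expPotential] at hvar
  set δ := nodePotential x - expPotential (randomMatching G p) x with hδ
  obtain ⟨v⟩ := hconn.nonempty
  have hn : (0 : ℝ) < Fintype.card V := by exact_mod_cast Fintype.card_pos_iff.2 ⟨v⟩
  set H := (edgeHittingTime G).toReal with hH
  have hH0 : 0 ≤ H := ENNReal.toReal_nonneg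
  have hδ0 : 0 ≤ δ := le_trans
    (mul_nonneg (by positivity) (edgePotential_nonneg G x)) hdrift
  have hw : ∀ e ∈ G.edgeFinset, sqDiff x e / 2 ≤ 16 * (H / Fintype.card V) * δ := by
    intro e he
    have h1 : sqDiff x e ≤ 2 * H / (Fintype.card V * d) * edgePotential G x := by
      induction e with
      | h i j => exact sq_sub_le_edgeHittingTime hd hreg hconn x (by simpa using he)
    have h2 : edgePotential G x ≤ 16 * d * δ := by
      calc edgePotential G x = 16 * d * (1 / (16 * (d : ℝ)) * edgePotential G x) := by field_simp
        _ ≤ _ := by gcongr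
    calc sqDiff x e / 2 ≤ (2 * H / (Fintype.card V * d) * (16 * d * δ)) / 2 := by
          have := mul_le_mul_of_nonneg_left h2
            (show 0 ≤ 2 * H / (Fintype.card V * d) by positivity)
          linarith
      _ = _ := by field_simp
  have hdiag : ∑ e ∈ G.edgeFinset,
      (sqDiff x e / 2) ^ 2 * (randomMatching G p).real {M | e ∈ M.1.edgeSet}
      ≤ 16 * (H / Fintype.card V) * δ * δ := by
    nth_rw 2 [hδ]
    rw [nodePotential_sub_expPotential, Finset.mul_sum]
    refine Finset.sum_le_sum fun e he => ?_
    rw [sq, mul_assoc]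
    exact mul_le_mul_of_nonneg_right (hw e he)
      (mul_nonneg (div_nonneg (sqDiff_nonneg x e) zero_le_two) measureReal_nonneg)
  have hextra : 0 ≤ 16 * (H / Fintype.card V) * δ * δ := by positivity
  linarith

end DriftAndVariance

/-! ### The spectral bound -/

section SpectralBound
variable {V : Type*} [Fintype V] [DecidableEq V]

theorem sum_eigenvectorBasis_dotProduct_mul {A : Matrix V V ℝ} (hA : A.IsHermitian)
    (y z : V → ℝ) :
    ∑ k, (hA.eigenvectorBasis k).ofLp ⬝ᵥ y * ((hA.eigenvectorBasis k).ofLp ⬝ᵥ z) = y ⬝ᵥ z := by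
  have h := hA.eigenvectorBasis.sum_inner_mul_inner (WithLp.toLp 2 y) (WithLp.toLp 2 z)
  simp only [EuclideanSpace.inner_eq_star_dotProduct, star_trivial] at h
  rw [dotProduct_comm y z, ← h]
  exact Finset.sum_congr rfl fun k _ => by rw [dotProduct_comm z]

theorem eigenvectorBasis_dotProduct_mulVec {A : Matrix V V ℝ} (hA : A.IsHermitian) (k : V)
    (y : V → ℝ) :
    (hA.eigenvectorBasis k).ofLp ⬝ᵥ (A *ᵥ y)
      = hA.eigenvalues k * ((hA.eigenvectorBasis k).ofLp ⬝ᵥ y) := by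
  have hT : Aᵀ = A := by
    rw [← Matrix.conjTranspose_eq_transpose_of_trivial]
    exact hA.eq
  rw [Matrix.dotProduct_mulVec, ← Matrix.mulVec_transpose, hT, hA.mulVec_eigenvectorBasis,
    smul_dotProduct, smul_eq_mul]

/-- For a positive semidefinite matrix with a null vector `u`, the form on the complement of `u`
is at least the gap between the two smallest eigenvalues. If the gap is positive then the null
space is the line spanned by the last eigenvector, so that `y ⊥ u` has no component along it. -/
theorem eigenvalue_gap_mul_dotProduct_le {A : Matrix V V ℝ} (hA : A.IsHermitian)
    (hpsd : ∀ y, 0 ≤ y ⬝ᵥ (A *ᵥ y)) {u y : V → ℝ} (hu : u ≠ 0) (hAu : A *ᵥ u = 0)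
    (hyu : y ⬝ᵥ u = 0) (h2 : 2 ≤ Fintype.card V) :
    (hA.eigenvalues₀ ⟨Fintype.card V - 2, by omega⟩
      - hA.eigenvalues₀ ⟨Fintype.card V - 1, by omega⟩) * (y ⬝ᵥ y) ≤ y ⬝ᵥ (A *ᵥ y) := by
  set l1 := hA.eigenvalues₀ ⟨Fintype.card V - 2, by omega⟩ with hl1
  set l0 := hA.eigenvalues₀ ⟨Fintype.card V - 1, by omega⟩ with hl0
  rcases le_or_gt (l1 - l0) 0 with hgap | hgap
  · exact (mul_nonpos_of_nonpos_of_nonneg hgap (by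
      simpa using dotProduct_star_self_nonneg y)).trans (hpsd y)
  let σ : Fin (Fintype.card V) ≃ V := Fintype.equivOfCardEq (Fintype.card_fin _)
  have hev : ∀ k, hA.eigenvalues k = hA.eigenvalues₀ (σ.symm k) := fun k => rfl
  set k0 : V := σ ⟨Fintype.card V - 1, by omega⟩ with hk0
  have hev0 : hA.eigenvalues k0 = l0 := by rw [hev, hk0, Equiv.symm_apply_apply]
  have hev1 : ∀ k, k ≠ k0 → l1 ≤ hA.eigenvalues k := by
    intro k hk
    rw [hev]
    refine hA.eigenvalues₀_antitone ?_
    have h1 : (σ.symm k) ≠ ⟨Fintype.card V - 1, by omega⟩ := fun h =>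
      hk (by rw [hk0, ← h, Equiv.apply_symm_apply])
    rw [Fin.le_def]
    have h3 : (σ.symm k).val ≠ Fintype.card V - 1 := fun h => h1 (Fin.ext h)
    have h4 := (σ.symm k).isLt
    simp only
    omega
  set b : V → V → ℝ := fun k => (hA.eigenvectorBasis k).ofLp with hb
  have hself : ∀ k, b k ⬝ᵥ b k = 1 := by
    intro k
    have h := hA.eigenvectorBasis.inner_eq_one k
    rwa [EuclideanSpace.inner_eq_star_dotProduct, star_trivial] at h
  have hl0nn : 0 ≤ l0 := by
    have h := hpsd (b k0)
    rw [hb, eigenvectorBasis_dotProduct_mulVec hA] at h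
    have h' := hself k0
    rw [hb] at h'
    simp only at h h'
    rwa [h', mul_one, hev0] at h
  have hbu : ∀ k, k ≠ k0 → b k ⬝ᵥ u = 0 := by
    intro k hk
    have h := eigenvectorBasis_dotProduct_mulVec hA k u
    rw [hAu, dotProduct_zero] at h
    refine (mul_eq_zero.1 h.symm).resolve_left ?_
    have := hev1 k hk
    linarith
  have hparseval : ∀ z, (b k0 ⬝ᵥ z) * (b k0 ⬝ᵥ u) = z ⬝ᵥ u := by
    intro z
    rw [← sum_eigenvectorBasis_dotProduct_mul hA z u, Finset.sum_eq_single k0]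
    · intro k _ hk
      rw [show (hA.eigenvectorBasis k).ofLp ⬝ᵥ u = 0 from hbu k hk, mul_zero]
    · simp
  have hk0u : b k0 ⬝ᵥ u ≠ 0 := by
    intro h
    have h1 := hparseval u
    rw [h, mul_zero] at h1
    exact hu (dotProduct_self_eq_zero.1 h1.symm)
  have hk0y : b k0 ⬝ᵥ y = 0 := by
    have h1 := hparseval y
    rw [hyu] at h1
    exact (mul_eq_zero.1 h1).resolve_right hk0u
  rw [← sum_eigenvectorBasis_dotProduct_mul hA y y,
    ← sum_eigenvectorBasis_dotProduct_mul hA y (A *ᵥ y), Finset.mul_sum]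
  refine Finset.sum_le_sum fun k _ => ?_
  rw [eigenvectorBasis_dotProduct_mulVec hA]
  by_cases hk : k = k0
  · rw [hk, show (hA.eigenvectorBasis k0).ofLp ⬝ᵥ y = 0 from hk0y]
    simp
  · have := mul_le_mul_of_nonneg_right (show l1 - l0 ≤ hA.eigenvalues k by linarith [hev1 k hk])
      (mul_self_nonneg ((hA.eigenvectorBasis k).ofLp ⬝ᵥ y))
    linarith

variable {G : SimpleGraph V} [DecidableRel G.Adj] {d : ℕ}

theorem normLaplacian_mulVec (hd : 0 < d) (hreg : G.IsRegularOfDegree d) (x : V → ℝ) :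
    normLaplacian G d *ᵥ x = (d : ℝ)⁻¹ • (G.lapMatrix ℝ *ᵥ x) := by
  have hd' : (d : ℝ) ≠ 0 := by exact_mod_cast hd.ne'
  ext k
  rw [normLaplacian, Matrix.sub_mulVec, Matrix.smul_mulVec, Matrix.one_mulVec, Pi.sub_apply,
    Pi.smul_apply, Pi.smul_apply, SimpleGraph.adjMatrix_mulVec_apply,
    SimpleGraph.lapMatrix_mulVec_apply, hreg k, smul_eq_mul, smul_eq_mul]
  field_simp

/-- The Poincaré inequality of a regular graph. -/
theorem spectralGap_mul_nodePotential_le (hd : 0 < d) (hreg : G.IsRegularOfDegree d)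
    (hV : Nonempty V) (x : V → ℝ) :
    d * spectralGap G d * nodePotential x ≤ edgePotential G x := by
  obtain ⟨v⟩ := hV
  have h2 : 2 ≤ Fintype.card V := by
    have h := G.degree_lt_card_verts v
    rw [hreg v] at h
    omega
  have hn : (Fintype.card V : ℝ) ≠ 0 := by
    have : Fintype.card V ≠ 0 := by omega
    exact_mod_cast this
  have hd' : (0 : ℝ) < d := by exact_mod_cast hd
  set m := (∑ j, x j) / (Fintype.card V : ℝ) with hm
  set y : V → ℝ := fun i => x i - m with hy
  have hyy : y ⬝ᵥ y = nodePotential x := by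
    simp only [dotProduct, nodePotential, hy, hm, sq]
  have hquad : ∀ z, z ⬝ᵥ (normLaplacian G d *ᵥ z) = (d : ℝ)⁻¹ * edgePotential G z := by
    intro z
    rw [normLaplacian_mulVec hd hreg, dotProduct_smul, dotProduct_lapMatrix_self, smul_eq_mul]
  have hy1 : y ⬝ᵥ (fun _ => 1) = 0 := by
    simp only [dotProduct, hy, mul_one, Finset.sum_sub_distrib, Finset.sum_const,
      Finset.card_univ, nsmul_eq_mul, hm]
    field_simp
    ring
  have hedge : edgePotential G y = edgePotential G x := by
    refine Finset.sum_congr rfl fun e _ => ?_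
    induction e with
    | h i j => simp [hy]
  have h := eigenvalue_gap_mul_dotProduct_le (normLaplacian_isHermitian G d)
    (fun z => by
      rw [hquad]
      exact mul_nonneg (by positivity) (edgePotential_nonneg G z))
    (u := fun _ => 1) (y := y) (fun h => one_ne_zero (congrFun h v))
    (by rw [normLaplacian_mulVec hd hreg, SimpleGraph.lapMatrix_mulVec_const_eq_zero, smul_zero])
    hy1 h2
  rw [hyy, hquad, hedge] at h
  rw [spectralGap, dif_pos h2]
  calc _ = d * (((normLaplacian_isHermitian G d).eigenvalues₀ ⟨Fintype.card V - 2, by omega⟩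
      - (normLaplacian_isHermitian G d).eigenvalues₀ ⟨Fintype.card V - 1, by omega⟩)
        * nodePotential x) := by ring
    _ ≤ d * ((d : ℝ)⁻¹ * edgePotential G x) := mul_le_mul_of_nonneg_left h hd'.le
    _ = edgePotential G x := by rw [← mul_assoc, mul_inv_cancel₀ hd'.ne', one_mul]

end SpectralBound

/-! ### The resistance bound -/

section ResistanceBound
variable {V : Type*} [Fintype V] [DecidableEq V] {G : SimpleGraph V} [DecidableRel G.Adj] {d : ℕ}

theorem lapMatrix_mulVec_eq_sum_sub (f : V → ℝ) (k : V) :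
    (G.lapMatrix ℝ *ᵥ f) k = ∑ l ∈ G.neighborFinset k, (f k - f l) := by
  rw [SimpleGraph.lapMatrix_mulVec_apply, Finset.sum_sub_distrib, Finset.sum_const,
    SimpleGraph.card_neighborFinset_eq_degree, nsmul_eq_mul]

theorem isHarmonicWithPoles_iff (hd : 0 < d) (hreg : G.IsRegularOfDegree d) {f : V → ℝ}
    {i j : V} :
    IsHarmonicWithPoles G f i j ↔ ∀ k, k ≠ i → k ≠ j → (G.lapMatrix ℝ *ᵥ f) k = 0 := by
  have hd' : (d : ℝ) ≠ 0 := by exact_mod_cast hd.ne'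
  refine forall_congr' fun k => imp_congr_right fun _ => imp_congr_right fun _ => ?_
  rw [SimpleGraph.lapMatrix_mulVec_apply, hreg k, sub_eq_zero, one_div, eq_inv_mul_iff_mul_eq₀ hd']

/-- The maximum principle: a function that is harmonic off `i` and `j` and smaller at `j` than
at `i` is largest at `i`. -/
theorem le_of_harmonic (hconn : G.Connected) {f : V → ℝ} {i j : V} (hij : f j < f i)
    (hf : ∀ k, k ≠ i → k ≠ j → (G.lapMatrix ℝ *ᵥ f) k = 0) (k : V) : f k ≤ f i := by
  have := hconn.nonempty
  obtain ⟨m, hm⟩ := Finite.exists_max f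
  by_contra! hk
  have him : f i < f m := hk.trans_le (hm k)
  have hall : ∀ v, f v = f m := by
    intro v
    have hr := (SimpleGraph.reachable_iff_reflTransGen m v).1 (hconn.preconnected m v)
    induction hr with
    | refl => rfl
    | @tail v w _ hvw ih =>
      have h0 := hf v (by rintro rfl; linarith) (by rintro rfl; linarith)
      rw [lapMatrix_mulVec_eq_sum_sub, Finset.sum_eq_zero_iff_of_nonneg
        (fun l _ => by linarith [hm l])] at h0
      linarith [h0 w (by simpa using hvw)]
  linarith [hall i]

/-- The commute time identity `n d R(i, j) = H(i, j) + H(j, i)`. -/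
theorem effResistance_eq (hd : 0 < d) (hreg : G.IsRegularOfDegree d) (hconn : G.Connected)
    {i j : V} (hij : i ≠ j) :
    effResistance G i j
      = ENNReal.ofReal (((hittingTime G i j).toReal + (hittingTime G j i).toReal)
          / (Fintype.card V * d)) := by
  have hn : (0 : ℝ) < Fintype.card V := by exact_mod_cast Fintype.card_pos_iff.2 ⟨i⟩
  have hc : (0 : ℝ) < Fintype.card V * d := mul_pos hn (by exact_mod_cast hd)
  have hL := lapMatrix_commutePotential_left hd hreg hconn hij
  have hR := lapMatrix_commutePotential_right hd hreg hconn hij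
  have hO : ∀ k, k ≠ i → k ≠ j → (G.lapMatrix ℝ *ᵥ commutePotential G i j) k = 0 :=
    fun k => lapMatrix_commutePotential_of_ne hd hreg hconn
  have hsub := commutePotential_sub (G := G) i j
  have hpos : 0 < (hittingTime G i j).toReal + (hittingTime G j i).toReal := by
    linarith [one_le_toReal_hittingTime hd hreg hconn hij,
      one_le_toReal_hittingTime hd hreg hconn hij.symm]
  set C := (hittingTime G i j).toReal + (hittingTime G j i).toReal
  set c : ℝ := Fintype.card V * d
  refine le_antisymm ?_ ?_
  -- Any admissible `f` carries a current of at most `s`; testing the Dirichlet principle of the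
  -- commute potential on `f` bounds its ratio.
  · refine iSup_le fun f => iSup_le fun hf => iSup_le fun hne => ?_
    rw [isHarmonicWithPoles_iff hd hreg] at hf
    set s := ∑ k ∈ G.neighborFinset i, |f k - f i|
    have hs : |(G.lapMatrix ℝ *ᵥ f) i| ≤ s := by
      rw [lapMatrix_mulVec_eq_sum_sub]
      refine (Finset.abs_sum_le_sum_abs _ _).trans (Finset.sum_le_sum fun k _ => ?_)
      rw [abs_sub_comm]
    have hfj : (G.lapMatrix ℝ *ᵥ f) j = -(G.lapMatrix ℝ *ᵥ f) i := by
      have h := sum_lapMatrix_mulVec G f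
      rw [Finset.sum_eq_add i j hij (fun k _ h => hf k h.1 h.2) (by simp) (by simp)] at h
      linarith
    have henergy := dotProduct_lapMatrix_of_poles G hij rfl hfj hf f
    rw [dotProduct_lapMatrix_self] at henergy
    have h := sq_mul_sub_le_of_poles G hij hL hR hO f
    rw [hsub, henergy] at h
    set a := (G.lapMatrix ℝ *ᵥ f) i
    have hD : 0 < |f i - f j| := abs_pos.2 (sub_ne_zero.2 hne)
    have h1 : c * |f i - f j| ≤ s * C := by
      have h2 : (c * |f i - f j|) * (c * |f i - f j|) ≤ (s * C) * (c * |f i - f j|) := by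
        calc (c * |f i - f j|) * (c * |f i - f j|) = (c * (f i - f j)) ^ 2 := by
              rw [mul_pow, ← sq_abs (f i - f j)]; ring
          _ ≤ a * (f i - f j) * (c * C) := h
          _ ≤ |a * (f i - f j)| * (c * C) := by gcongr; exact le_abs_self _
          _ = |a| * C * (c * |f i - f j|) := by rw [abs_mul]; ring
          _ ≤ _ := by gcongr
      exact le_of_mul_le_mul_right h2 (by positivity)
    have hs0 : 0 < s := by
      by_contra! hs0
      have : s * C ≤ 0 := mul_nonpos_of_nonpos_of_nonneg hs0 hpos.le
      linarith [mul_pos hc hD]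
    rw [← ENNReal.ofReal_div_of_pos hs0]
    refine ENNReal.ofReal_le_ofReal ?_
    rw [div_le_div_iff₀ hs0 hc]
    linarith
  -- For the commute potential itself no term `f k - f i` is positive, so that the absolute values in
  -- the denominator add up to the current.
  · have hmax := le_of_harmonic hconn (f := commutePotential G i j) (i := i) (j := j)
      (by linarith) hO
    have hs : ∑ k ∈ G.neighborFinset i, |commutePotential G i j k - commutePotential G i j i|
        = c := by
      rw [← hL, lapMatrix_mulVec_eq_sum_sub]
      refine Finset.sum_congr rfl fun k _ => ?_
      rw [abs_sub_comm, abs_of_nonneg (by linarith [hmax k])]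
    refine le_iSup_of_le (commutePotential G i j) (le_iSup_of_le
      ((isHarmonicWithPoles_iff hd hreg).2 hO) (le_iSup_of_le (fun h => by linarith) ?_))
    rw [hs, hsub, abs_of_pos hpos, ENNReal.ofReal_div_of_pos hc]

theorem resDiameter_ne_top (hd : 0 < d) (hreg : G.IsRegularOfDegree d) (hconn : G.Connected) :
    resDiameter G ≠ ⊤ := by
  refine iSup_ne_top fun i => iSup_ne_top fun j => ?_
  by_cases hij : i = j
  · simp [hij, effResistance]
  · rw [effResistance_eq hd hreg hconn hij]
    exact ENNReal.ofReal_ne_top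

theorem sq_sub_le_resDiameter_mul (hd : 0 < d) (hreg : G.IsRegularOfDegree d)
    (hconn : G.Connected) (x : V → ℝ) (i j : V) :
    (x i - x j) ^ 2 ≤ (resDiameter G).toReal * edgePotential G x := by
  by_cases hij : i = j
  · subst hij
    simpa using mul_nonneg ENNReal.toReal_nonneg (edgePotential_nonneg G x)
  have hn : (0 : ℝ) < Fintype.card V := by exact_mod_cast Fintype.card_pos_iff.2 ⟨i⟩
  have hc : (0 : ℝ) < Fintype.card V * d := mul_pos hn (by exact_mod_cast hd)
  have hR : effResistance G i j ≤ resDiameter G := le_iSup_of_le i (le_iSup_of_le j le_rfl)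
  rw [effResistance_eq hd hreg hconn hij,
    ENNReal.ofReal_le_iff_le_toReal (resDiameter_ne_top hd hreg hconn)] at hR
  refine le_trans ?_ (mul_le_mul_of_nonneg_right hR (edgePotential_nonneg G x))
  have h := sq_mul_sub_le_of_poles G hij
    (lapMatrix_commutePotential_left hd hreg hconn hij)
    (lapMatrix_commutePotential_right hd hreg hconn hij)
    (fun k => lapMatrix_commutePotential_of_ne hd hreg hconn) x
  rw [commutePotential_sub] at h
  rw [div_mul_eq_mul_div, le_div_iff₀ hc]
  refine le_of_mul_le_mul_left (a := (Fintype.card V : ℝ) * d) ?_ hc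
  linarith

end ResistanceBound

/-! ### Stochastic vectors and the drift function -/

section Stochastic
variable {V : Type*} [Fintype V]

theorem nodePotential_nonneg (x : V → ℝ) : 0 ≤ nodePotential x :=
  Finset.sum_nonneg fun _ _ => sq_nonneg _

theorem nodePotential_le_of_mem_stdSimplex {x : V → ℝ} (hx : x ∈ stdSimplex ℝ V) {a : ℝ}
    (ha : ∀ v, x v ≤ a) : nodePotential x ≤ a - 1 / Fintype.card V := by
  rw [nodePotential_eq, hx.2, one_pow]
  have h : ∑ i, x i ^ 2 ≤ ∑ i, a * x i :=
    Finset.sum_le_sum fun i _ => by rw [sq]; exact mul_le_mul_of_nonneg_right (ha i) (hx.1 i)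
  rw [← Finset.mul_sum, hx.2, mul_one] at h
  linarith

theorem exists_le_one_div_card {x : V → ℝ} (hx : x ∈ stdSimplex ℝ V) :
    ∃ v, x v ≤ 1 / Fintype.card V := by
  have hne : Nonempty V := by
    by_contra h
    rw [not_nonempty_iff] at h
    simpa using hx.2
  have hn : (Fintype.card V : ℝ) ≠ 0 := by exact_mod_cast Fintype.card_ne_zero
  obtain ⟨v, -, hv⟩ := Finset.exists_le_of_sum_le (s := Finset.univ) (f := x)
    (g := fun _ => 1 / (Fintype.card V : ℝ)) Finset.univ_nonempty
    (by rw [hx.2]; simp [hn])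
  exact ⟨v, hv⟩

variable [DecidableEq V] {G : SimpleGraph V} [DecidableRel G.Adj] {d : ℕ}

theorem sq_nodePotential_le (hd : 0 < d) (hreg : G.IsRegularOfDegree d)
    (hconn : G.Connected) {x : V → ℝ} (hx : x ∈ stdSimplex ℝ V) :
    nodePotential x ^ 2 ≤ (resDiameter G).toReal * edgePotential G x := by
  have := hconn.nonempty
  obtain ⟨u, hu⟩ := Finite.exists_max x
  obtain ⟨w, hw⟩ := exists_le_one_div_card hx
  refine le_trans ?_ (sq_sub_le_resDiameter_mul hd hreg hconn x u w)
  gcongr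
  · exact nodePotential_nonneg x
  · linarith [nodePotential_le_of_mem_stdSimplex hx hu]

/-- A shortest path from a node of maximal load to a node of load below `t = 1 / n + Φ / 3` has
only nodes of load at least `t` before its end, hence at most `1 / t` edges, while the load falls
by at least `2 Φ / 3` along it. The choice `Φ / 3` maximizes `s (Φ - s)²`. -/
theorem cube_nodePotential_le (hconn : G.Connected) {x : V → ℝ} (hx : x ∈ stdSimplex ℝ V) :
    4 / 27 * nodePotential x ^ 3 ≤ edgePotential G x := by
  have := hconn.nonempty
  set Φ := nodePotential x with hΦ
  rcases (nodePotential_nonneg x).eq_or_lt with h0 | h0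
  · rw [hΦ, ← h0]
    simpa using edgePotential_nonneg G x
  rw [← hΦ] at h0
  obtain ⟨u, hu⟩ := Finite.exists_max x
  have hΦu : Φ ≤ x u - 1 / Fintype.card V := nodePotential_le_of_mem_stdSimplex hx hu
  set t : ℝ := 1 / Fintype.card V + Φ / 3 with ht
  have ht0 : Φ / 3 ≤ t := by
    have : (0 : ℝ) ≤ 1 / Fintype.card V := by positivity
    linarith
  obtain ⟨w, hwt, hwmin⟩ : ∃ w, x w < t ∧ ∀ v, x v < t → G.dist u w ≤ G.dist u v := by
    obtain ⟨w₀, hw₀⟩ := exists_le_one_div_card hx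
    obtain ⟨w, hw, hmin⟩ := Finset.exists_min_image (Finset.univ.filter fun v => x v < t)
      (fun v => G.dist u v) ⟨w₀, by simp only [Finset.mem_filter_univ]; linarith⟩
    simp only [Finset.mem_filter_univ] at hw hmin
    exact ⟨w, hw, hmin⟩
  obtain ⟨p, hp, hlen⟩ := hconn.exists_path_of_dist u w
  have hbig : ∀ i ∈ Finset.range p.length, t ≤ x (p.getVert i) := by
    intro i hi
    rw [Finset.mem_range] at hi
    by_contra! hlt
    have h1 := hwmin _ hlt
    have h2 : G.dist u (p.getVert i) ≤ (p.take i).length := SimpleGraph.dist_le _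
    rw [SimpleGraph.Walk.take_length] at h2
    omega
  have hlt : p.length * t ≤ 1 := by
    calc p.length * t = ∑ i ∈ Finset.range p.length, t := by simp
      _ ≤ ∑ i ∈ Finset.range p.length, x (p.getVert i) := Finset.sum_le_sum hbig
      _ = ∑ v ∈ (Finset.range p.length).image p.getVert, x v := by
        rw [Finset.sum_image]
        intro a ha b hb hab
        simp only [Finset.coe_range, Set.mem_Iio] at ha hb
        exact hp.getVert_injOn ha.le hb.le hab
      _ ≤ ∑ v, x v := Finset.sum_le_sum_of_subset_of_nonneg (Finset.subset_univ _)
        fun v _ _ => hx.1 v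
      _ = 1 := hx.2
  have hpath := sq_sub_le_length_mul_edgePotential G x hp
  have hΨ := edgePotential_nonneg G x
  have hdrop : (2 / 3 * Φ) ^ 2 ≤ (x u - x w) ^ 2 := by
    gcongr
    linarith
  calc 4 / 27 * Φ ^ 3 = (2 / 3 * Φ) ^ 2 * (Φ / 3) := by ring
    _ ≤ (p.length * edgePotential G x) * t := by
      gcongr
      exact hdrop.trans hpath
    _ = (p.length * t) * edgePotential G x := by ring
    _ ≤ 1 * edgePotential G x := by gcongr
    _ = edgePotential G x := one_mul _

theorem driftFun_nodePotential_le (hd : 0 < d) (hreg : G.IsRegularOfDegree d)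
    (hconn : G.Connected) {x : V → ℝ} (hx : x ∈ stdSimplex ℝ V) :
    driftFun G d (nodePotential x) ≤ 1 / (16 * (d : ℝ)) * edgePotential G x := by
  refine mul_le_mul_of_nonneg_left (max_le (max_le ?_ ?_) ?_) (by positivity)
  · exact spectralGap_mul_nodePotential_le hd hreg hconn.nonempty x
  · refine div_le_of_le_mul₀ ENNReal.toReal_nonneg (edgePotential_nonneg G x) ?_
    rw [mul_comm]
    exact sq_nodePotential_le hd hreg hconn hx
  · exact cube_nodePotential_le hconn hx

theorem driftFun_pos (hd : 0 < d) {x : ℝ} (hx : 0 < x) : 0 < driftFun G d x :=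
  mul_pos (by positivity) (lt_max_of_lt_right (by positivity))

theorem driftFun_nonneg {x : ℝ} (hx : 0 ≤ x) : 0 ≤ driftFun G d x :=
  mul_nonneg (by positivity) (le_max_of_le_right (by positivity))

theorem strictMonoOn_driftFun (hd : 0 < d) : StrictMonoOn (driftFun G d) (Set.Ici 0) := by
  intro a ha b hb hab
  rw [Set.mem_Ici] at ha
  have hb0 : 0 < b := lt_of_le_of_lt ha hab
  have hcube : 0 < 4 / 27 * b ^ 3 := by positivity
  -- A term with a coefficient that is not positive lies below the positive cubic term.
  refine mul_lt_mul_of_pos_left (max_lt (max_lt ?_ ?_) ?_) (by positivity)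
  · rcases le_or_gt (d * spectralGap G d) 0 with h | h
    · exact lt_max_of_lt_right ((mul_nonpos_of_nonpos_of_nonneg h ha).trans_lt hcube)
    · exact lt_max_of_lt_left (lt_max_of_lt_left (mul_lt_mul_of_pos_left hab h))
  · rcases (ENNReal.toReal_nonneg (a := resDiameter G)).eq_or_lt with h | h
    · exact lt_max_of_lt_right (by rw [← h, div_zero]; exact hcube)
    · exact lt_max_of_lt_left (lt_max_of_lt_right (by gcongr))
  · exact lt_max_of_lt_right (by gcongr)

end Stochastic
end LoadBalancing

open LoadBalancing
theorem mainTheorem9 {V : Type*} [Fintype V] [DecidableEq V] (G : SimpleGraph V)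
    [DecidableRel G.Adj] (d : ℕ) (hd : 0 < d) (hreg : G.IsRegularOfDegree d)
    (p : unitInterval)
    (hp : (p : ℝ) = 1 / (4 * (d : ℝ)) - 1 / (16 * (d : ℝ) ^ 2) ∨
      (p : ℝ) = 1 / (4 * (d : ℝ)) - 1 / (64 * (d : ℝ) ^ 2)) :
    (∀ x : V → ℝ, nodePotential x - expPotential (randomMatching G p) x
        ≥ 1 / (16 * (d : ℝ)) * edgePotential G x) ∧
    (G.Connected →
      edgeHittingTime G ≠ ⊤ ∧
      (∀ x : V → ℝ, varPotential (randomMatching G p) x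
        ≤ (32 * ((edgeHittingTime G).toReal / (Fintype.card V : ℝ)) + 4)
          * (nodePotential x - expPotential (randomMatching G p) x) ^ 2) ∧
      IsGood (randomMatching G p) (driftFun G d) (sigmaSq G)) := by
  have hdpos : (0 : ℝ) < d := by exact_mod_cast hd
  have hle : 1 / (64 * (d : ℝ) ^ 2) ≤ 1 / (16 * (d : ℝ) ^ 2) := by gcongr; norm_num
  have hnn : 0 ≤ 1 / (64 * (d : ℝ) ^ 2) := by positivity
  have hp0 : 1 / (4 * (d : ℝ)) - 1 / (16 * (d : ℝ) ^ 2) ≤ p := by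
    rcases hp with h | h <;> linarith
  have hp1 : (p : ℝ) ≤ 1 / (4 * (d : ℝ)) := by rcases hp with h | h <;> linarith
  have hdrift := drift_ge_edgePotential hd hreg hp0 hp1
  refine ⟨hdrift, fun hconn => ?_⟩
  have hvar := varPotential_randomMatching_le hd hreg hconn hp0 hp1
  refine ⟨edgeHittingTime_ne_top hd hreg hconn, hvar, ?_⟩
  have hσ : 0 ≤ (edgeHittingTime G).toReal / (Fintype.card V : ℝ) := by positivity
  exact
    { isProbabilityMeasure := inferInstance
      nonneg := fun x hx => driftFun_nonneg hx
      pos := fun x hx => driftFun_pos hd hx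
      increasing := strictMonoOn_driftFun hd
      one_lt := by rw [sigmaSq]; linarith
      drift := fun x hx => (driftFun_nodePotential_le hd hreg hconn hx).trans (hdrift x)
      variance_le := fun x _ => by
        have h : sigmaSq G - 1
            = 32 * ((edgeHittingTime G).toReal / (Fintype.card V : ℝ)) + 4 := by
          rw [sigmaSq]
          ring
        rw [h]
        exact hvar x }
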